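/- Proposition 1. Let $\omega_m>0$ and, for real parameters $(\gamma,\hat\delta)$, consider the Ince equation $$(1+\hat\delta\gamma\cos 2t)\,\ddot x-2\hat\delta\gamma\sin 2t\;\dot x+\frac{4\hat\delta}{\omega_m^2}\,x=0,$$ which is the (time-rescaled) linearisation about the origin of the undamped, unforced Helmholtz oscillator with mass $m(t)=\delta+\gamma\sin\omega_m t$, $\hat\delta=1/\delta$. For every integer $k\ge 1$ put $\hat\delta_0=\left(\frac{(2k-1)\omega_m}{2}\right)^2$. Then there are exactly two transition curves emanating from the point $(\gamma,\hat\delta)=(0,\hat\delta_0)$: there are functions $a,b$, real-analytic at $0$, with $a(0)=b(0)=\hat\delta_0$, such that for all $(\gamma,\hat\delta)$ in a neighbourhood of $(0,\hat\delta_0)$ 1. the equation has a nontrivial even $2\pi$-periodic solution if and only if $\hat\delta=a(\gamma)$, and a nontrivial odd $2\pi$-periodic solution if and only if $\hat\delta=b(\gamma)$; 2. $(\gamma,\hat\delta)$ lies on the stability boundary (the topological boundary of the set of parameters for which the origin $(x,\dot x)=(0,0)$ is Lyapunov stable) if and only if $\hat\delta=a(\gamma)$ or $\hat\delta=b(\gamma)$;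 3. the origin is unstable if and only if $\gamma\neq 0$ and $\hat\delta$ lies in the closed interval with endpoints $a(\gamma)$ and $b(\gamma)$ (the $k$-th instability tongue). The two curves coincide to order $\gamma^{2k-2}$ and split at order $\gamma^{2k-1}$: $a^{(j)}(0)=b^{(j)}(0)$ for $0\le j\le 2k-2$, and $a^{(2k-1)}(0)\neq b^{(2k-1)}(0)$. Consequently the width $|a(\gamma)-b(\gamma)|$ of the $k$-th instability tongue is of exact order $|\gamma|^{2k-1}$ as $\gamma\to 0$. -/

import Mathlib

open scoped Topology Asymptotics

/-- `x` is a (twice differentiable, global) solution of the linearisation of the undamped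
Helmholtz oscillator with periodically varying mass about the origin, in the rescaled form of an
Ince equation:
`(1 + δ γ cos 2t) x'' - 2 δ γ sin 2t x' + 4 (δ / ω²) x = 0`. -/
def IsInceSolution (ω γ δ : ℝ) (x : ℝ → ℝ) : Prop :=
  Differentiable ℝ x ∧ Differentiable ℝ (deriv x) ∧
    ∀ t : ℝ, (1 + δ * γ * Real.cos (2 * t)) * deriv (deriv x) t
      - 2 * (δ * γ) * Real.sin (2 * t) * deriv x t + 4 * (δ / ω ^ 2) * x t = 0

/-- Lyapunov stability of the origin `(x, x') = (0, 0)` at the parameters `(γ, δ)`. -/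
def OriginStable (ω γ δ : ℝ) : Prop :=
  ∀ ε > 0, ∃ η > 0, ∀ x : ℝ → ℝ, IsInceSolution ω γ δ x → |x 0| < η → |deriv x 0| < η →
    ∀ t ≥ 0, |x t| < ε ∧ |deriv x t| < ε

/-- The stability boundary in the `(γ, δ)` parameter plane: the frontier of the set of parameters
at which the origin is stable. -/
def stabilityBoundary (ω : ℝ) : Set (ℝ × ℝ) :=
  frontier {p : ℝ × ℝ | OriginStable ω p.1 p.2}

/-- At `(γ, δ)` there is a nontrivial even solution of period `2π`, which is twice the period `π`
of the coefficients. -/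
def HasEvenPeriodicSolution (ω γ δ : ℝ) : Prop :=
  ∃ x : ℝ → ℝ, IsInceSolution ω γ δ x ∧ x ≠ 0 ∧ Function.Periodic x (2 * Real.pi) ∧
    Function.Even x

/-- At `(γ, δ)` there is a nontrivial odd solution of period `2π`. -/
def HasOddPeriodicSolution (ω γ δ : ℝ) : Prop :=
  ∃ x : ℝ → ℝ, IsInceSolution ω γ δ x ∧ x ≠ 0 ∧ Function.Periodic x (2 * Real.pi) ∧
    Function.Odd x

/-!
With `ε = δ γ` and `l = 4 δ / ω²` the equation is the system `(1 + ε cos 2t) x' = y`, `y' = -l x`.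
Let `(x₁, y₁)` and `(x₂, y₂)` be its solutions with initial values `(1, 0)` and `(0, 1)`. The
coefficients are even and `π`-periodic, so the half-period values `x₁(π/2)` and `y₂(π/2)` decide
both the stability of the origin and the existence of even and odd `2π`-periodic solutions.
Shifting time by `π/2` turns `y₂(π/2)` into `x₁(π/2)` for the parameter `-γ`. Hence
`b γ = a (-γ)`, where `a` comes from the analytic implicit function theorem applied to
`x₁(π/2) = 0`. Near the resonance the origin is stable exactly on the axis `γ = 0` and outside the
closed wedge between the two curves.

For the width, put `K = k - 1`. Over a quarter period the sine coefficients of `x'` satisfy a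
three-term recurrence with off-diagonal entries `γ/2`, boundary term `∓γ/2` and spectral parameter
`1/δ`; for small `γ` the solutions `z`, `w` belonging to the two curves are concentrated at the
index `K`. Lagrange's identity gives `(1/a - 1/b) ∑ z_j w_j = γ z_0 w_0`. Each step from `K` down
to `0` costs exactly one factor `γ` in both `z` and `w`, so the width has exact order `γ^(2K+1)`.
-/

open scoped Real BoundedContinuousFunction

section WeightedPrimitive

variable {E : Type*} [NormedAddCommGroup E] [NormedSpace ℝ E]

lemma intervalIntegrable_cosh_smul (L : ℝ) (f : ℝ →ᵇ E) (a b : ℝ) :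
    IntervalIntegrable (fun s => Real.cosh (L * s) • f s) MeasureTheory.volume a b :=
  Continuous.intervalIntegrable (by fun_prop) a b

lemma integral_cosh_mul_zero_left {L : ℝ} (hL : L ≠ 0) (t : ℝ) :
    ∫ s in (0 : ℝ)..t, Real.cosh (L * s) = Real.sinh (L * t) / L := by
  rw [intervalIntegral.integral_comp_mul_left (fun s => Real.cosh s) hL,
    intervalIntegral.integral_eq_sub_of_hasDerivAt (fun s _ => Real.hasDerivAt_sinh s)
      (Real.continuous_cosh.intervalIntegrable _ _), mul_zero, Real.sinh_zero, sub_zero,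
    smul_eq_mul, inv_mul_eq_div]

lemma norm_integral_cosh_smul_le {L : ℝ} (hL : 0 < L) (f : ℝ →ᵇ E) (t : ℝ) :
    ‖∫ s in (0 : ℝ)..t, Real.cosh (L * s) • f s‖ ≤ ‖f‖ / L * Real.cosh (L * t) := by
  have hsinh : |Real.sinh (L * t)| ≤ Real.cosh (L * t) := by
    rw [← abs_of_pos (Real.cosh_pos (L * t))]
    exact sq_le_sq.1 (by linarith [Real.cosh_sq (L * t)])
  calc ‖∫ s in (0 : ℝ)..t, Real.cosh (L * s) • f s‖
      ≤ |∫ s in (0 : ℝ)..t, Real.cosh (L * s) * ‖f‖| := by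
        refine intervalIntegral.norm_integral_le_abs_of_norm_le
          (Filter.Eventually.of_forall fun s => ?_)
          (Continuous.intervalIntegrable (by fun_prop) _ _)
        rw [norm_smul, Real.norm_of_nonneg (Real.cosh_pos _).le]
        exact mul_le_mul_of_nonneg_left (f.norm_coe_le_norm s) (Real.cosh_pos _).le
    _ = ‖f‖ / L * |Real.sinh (L * t)| := by
        rw [intervalIntegral.integral_mul_const, integral_cosh_mul_zero_left hL.ne', abs_mul,
          abs_div, abs_norm, abs_of_pos hL]
        ring
    _ ≤ ‖f‖ / L * Real.cosh (L * t) := by gcongr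

lemma norm_inv_cosh_smul_integral_le {L : ℝ} (hL : 0 < L) (f : ℝ →ᵇ E) (t : ℝ) :
    ‖(Real.cosh (L * t))⁻¹ • ∫ s in (0 : ℝ)..t, Real.cosh (L * s) • f s‖ ≤ ‖f‖ / L := by
  rw [norm_smul, norm_inv, Real.norm_of_nonneg (Real.cosh_pos _).le, inv_mul_le_iff₀'
    (Real.cosh_pos _)]
  exact norm_integral_cosh_smul_le hL f t

/-- The primitive `f ↦ (cosh Lt)⁻¹ ∫₀ᵗ cosh(Ls) f(s) ds` vanishing at `0`, conjugated by the
weight `cosh Lt`. The weight makes it an operator on *bounded* continuous functions, of norm at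
most `1 / L`. -/
noncomputable def weightedPrimitive (E : Type*) [NormedAddCommGroup E] [NormedSpace ℝ E]
    {L : ℝ} (hL : 0 < L) : (ℝ →ᵇ E) →L[ℝ] (ℝ →ᵇ E) :=
  LinearMap.mkContinuous
    { toFun := fun f => BoundedContinuousFunction.ofNormedAddCommGroup
        (fun t => (Real.cosh (L * t))⁻¹ • ∫ s in (0 : ℝ)..t, Real.cosh (L * s) • f s)
        (Continuous.smul (Continuous.inv₀ (by fun_prop) fun t => (Real.cosh_pos _).ne')
          (intervalIntegral.continuous_primitive (intervalIntegrable_cosh_smul L f) 0))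
        (‖f‖ / L) (norm_inv_cosh_smul_integral_le hL f)
      map_add' := fun f g => by
        ext t
        simp [intervalIntegral.integral_add (intervalIntegrable_cosh_smul L f 0 t)
          (intervalIntegrable_cosh_smul L g 0 t)]
      map_smul' := fun c f => by
        ext t
        simp [smul_comm _ c, intervalIntegral.integral_smul] }
    L⁻¹
    (fun f => by
      rw [inv_mul_eq_div]
      exact BoundedContinuousFunction.norm_ofNormedAddCommGroup_le _ (by positivity)
        (norm_inv_cosh_smul_integral_le hL f))

lemma cosh_smul_weightedPrimitive {L : ℝ} (hL : 0 < L) (f : ℝ →ᵇ E) (t : ℝ) :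
    Real.cosh (L * t) • weightedPrimitive E hL f t =
      ∫ s in (0 : ℝ)..t, Real.cosh (L * s) • f s :=
  smul_inv_smul₀ (Real.cosh_pos _).ne' _

lemma norm_weightedPrimitive_le {L : ℝ} (hL : 0 < L) : ‖weightedPrimitive E hL‖ ≤ L⁻¹ :=
  LinearMap.mkContinuous_norm_le _ (by positivity) _

end WeightedPrimitive

section FundamentalSolution

variable {R : Type*} [NormedRing R] [NormedAlgebra ℝ R]

/-- The constant function `1` divided by the weight `cosh Lt`, the inhomogeneous term of the
weighted integral equation. -/
noncomputable def weightedOne (R : Type*) [NormedRing R] [NormedAlgebra ℝ R] (L : ℝ) : ℝ →ᵇ R :=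
  BoundedContinuousFunction.ofNormedAddCommGroup (fun t => (Real.cosh (L * t))⁻¹ • (1 : R))
    (Continuous.smul (Continuous.inv₀ (by fun_prop) fun t => (Real.cosh_pos _).ne')
      continuous_const) ‖(1 : R)‖
    fun t => by
      rw [norm_smul, norm_inv, Real.norm_of_nonneg (Real.cosh_pos _).le]
      exact mul_le_of_le_one_left (norm_nonneg _) (inv_le_one_of_one_le₀ (Real.one_le_cosh _))

/-- The operator `1 - J A`, where `J` is the weighted primitive: `X ↦ cosh(Lt) X` carries its
kernel equation `(1 - J A) X = (cosh Lt)⁻¹` to the integral equation `Φ = 1 + ∫₀ᵗ A Φ`. -/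
noncomputable def volterraOperator {L : ℝ} (hL : 0 < L) (A : ℝ →ᵇ R) :
    (ℝ →ᵇ R) →L[ℝ] (ℝ →ᵇ R) :=
  1 - (weightedPrimitive R hL).comp (ContinuousLinearMap.mul ℝ (ℝ →ᵇ R) A)

/-- The fundamental solution of `Φ' = A Φ` divided by the weight `cosh Lt`; meaningful when
`‖A‖ < L`. -/
noncomputable def weightedFundamentalSolution {L : ℝ} (hL : 0 < L) (A : ℝ →ᵇ R) : ℝ →ᵇ R :=
  Ring.inverse (volterraOperator hL A) (weightedOne R L)

/-- The solution of `Φ' = A Φ`, `Φ 0 = 1`, for a bounded continuous coefficient `A`. The weight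
`‖A‖ + 1` is immaterial: any `L > ‖A‖` gives the same function. -/
noncomputable def fundamentalSolution (A : ℝ →ᵇ R) (t : ℝ) : R :=
  Real.cosh ((‖A‖ + 1) * t) •
    weightedFundamentalSolution (by positivity : (0 : ℝ) < ‖A‖ + 1) A t

lemma eq_of_hasDerivAt_mul {A : ℝ →ᵇ R} {f g : ℝ → R} (hf : ∀ t, HasDerivAt f (A t * f t) t)
    (hg : ∀ t, HasDerivAt g (A t * g t) t) (h0 : f 0 = g 0) : f = g := by
  have hlip (t : ℝ) : LipschitzOnWith ‖A‖₊ (fun x : R => A t * x) Set.univ := by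
    refine (LipschitzWith.of_dist_le_mul fun x y => ?_).lipschitzOnWith
    rw [dist_eq_norm, dist_eq_norm, ← mul_sub]
    exact (norm_mul_le _ _).trans
      (mul_le_mul_of_nonneg_right (A.norm_coe_le_norm t) (norm_nonneg _))
  exact ODE_solution_unique_univ (v := fun t x => A t * x) (s := fun _ => Set.univ) hlip
    (fun t => ⟨hf t, trivial⟩) (fun t => ⟨hg t, trivial⟩) h0

variable [CompleteSpace R]

lemma isUnit_volterraOperator {L : ℝ} (hL : 0 < L) {A : ℝ →ᵇ R} (hA : ‖A‖ < L) :
    IsUnit (volterraOperator hL A) := by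
  refine isUnit_one_sub_of_norm_lt_one (R := (ℝ →ᵇ R) →L[ℝ] (ℝ →ᵇ R)) ?_
  calc ‖(weightedPrimitive R hL).comp (ContinuousLinearMap.mul ℝ (ℝ →ᵇ R) A)‖
      ≤ ‖weightedPrimitive R hL‖ * ‖ContinuousLinearMap.mul ℝ (ℝ →ᵇ R) A‖ :=
        ContinuousLinearMap.opNorm_comp_le _ _
    _ ≤ L⁻¹ * ‖A‖ := by
        gcongr
        · exact norm_weightedPrimitive_le hL
        · exact ContinuousLinearMap.opNorm_mul_apply_le ℝ _ A
    _ < 1 := by rwa [inv_mul_lt_iff₀ hL, mul_one]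

lemma cosh_smul_weightedFundamentalSolution {L : ℝ} (hL : 0 < L) {A : ℝ →ᵇ R} (hA : ‖A‖ < L)
    (t : ℝ) :
    Real.cosh (L * t) • weightedFundamentalSolution hL A t =
      1 + ∫ s in (0 : ℝ)..t, A s * Real.cosh (L * s) • weightedFundamentalSolution hL A s := by
  set X := weightedFundamentalSolution hL A with hX
  have heq : volterraOperator hL A X = weightedOne R L := by
    rw [hX, weightedFundamentalSolution, ← mul_apply_eq_comp,
      Ring.mul_inverse_cancel _ (isUnit_volterraOperator hL hA), one_apply_eq_self]
  have ht : X t = (Real.cosh (L * t))⁻¹ • (1 : R) + weightedPrimitive R hL (A * X) t :=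
    sub_eq_iff_eq_add.1 (DFunLike.congr_fun heq t)
  rw [ht, smul_add, smul_inv_smul₀ (Real.cosh_pos _).ne', cosh_smul_weightedPrimitive]
  simp only [BoundedContinuousFunction.mul_apply, mul_smul_comm]

lemma hasDerivAt_cosh_smul_weightedFundamentalSolution {L : ℝ} (hL : 0 < L) {A : ℝ →ᵇ R}
    (hA : ‖A‖ < L) (t : ℝ) :
    HasDerivAt (fun t => Real.cosh (L * t) • weightedFundamentalSolution hL A t)
      (A t * Real.cosh (L * t) • weightedFundamentalSolution hL A t) t := by
  rw [funext (cosh_smul_weightedFundamentalSolution hL hA)]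
  refine HasDerivAt.const_add 1 (intervalIntegral.integral_hasDerivAt_right ?_ ?_ ?_)
  · exact Continuous.intervalIntegrable (by fun_prop) _ _
  · exact Continuous.stronglyMeasurableAtFilter (by fun_prop) _ _
  · fun_prop

lemma fundamentalSolution_eq_cosh_smul {L : ℝ} (hL : 0 < L) {A : ℝ →ᵇ R} (hA : ‖A‖ < L) :
    fundamentalSolution A = fun t => Real.cosh (L * t) • weightedFundamentalSolution hL A t := by
  have hA' : ‖A‖ < ‖A‖ + 1 := lt_add_one _
  refine eq_of_hasDerivAt_mul
    (hasDerivAt_cosh_smul_weightedFundamentalSolution (by positivity) hA')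
    (hasDerivAt_cosh_smul_weightedFundamentalSolution hL hA) ?_
  rw [cosh_smul_weightedFundamentalSolution hL hA, fundamentalSolution,
    cosh_smul_weightedFundamentalSolution _ hA', intervalIntegral.integral_same,
    intervalIntegral.integral_same]

lemma hasDerivAt_fundamentalSolution (A : ℝ →ᵇ R) (t : ℝ) :
    HasDerivAt (fundamentalSolution A) (A t * fundamentalSolution A t) t :=
  hasDerivAt_cosh_smul_weightedFundamentalSolution (by positivity) (lt_add_one ‖A‖) t

lemma fundamentalSolution_zero (A : ℝ →ᵇ R) : fundamentalSolution A 0 = 1 := by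
  rw [fundamentalSolution, cosh_smul_weightedFundamentalSolution _ (lt_add_one ‖A‖),
    intervalIntegral.integral_same, add_zero]

lemma fundamentalSolution_eventuallyEq {L : ℝ} (hL : 0 < L) {A : ℝ →ᵇ R} (hA : ‖A‖ < L) :
    fundamentalSolution =ᶠ[𝓝 A]
      fun B t => Real.cosh (L * t) • weightedFundamentalSolution hL B t := by
  filter_upwards [continuous_norm.continuousAt.eventually (gt_mem_nhds hA)] with B hB
  exact fundamentalSolution_eq_cosh_smul hL hB

lemma analyticAt_weightedFundamentalSolution {L : ℝ} (hL : 0 < L) {A : ℝ →ᵇ R} (hA : ‖A‖ < L) :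
    AnalyticAt ℝ (weightedFundamentalSolution hL) A := by
  obtain ⟨u, hu⟩ := isUnit_volterraOperator hL hA
  have hV : AnalyticAt ℝ (volterraOperator (R := R) hL) A :=
    analyticAt_const.sub (((ContinuousLinearMap.compL ℝ _ _ _ (weightedPrimitive R hL)).comp
      (ContinuousLinearMap.mul ℝ (ℝ →ᵇ R))).analyticAt A)
  have hinv : AnalyticAt ℝ (Ring.inverse : ((ℝ →ᵇ R) →L[ℝ] (ℝ →ᵇ R)) → _)
      (volterraOperator hL A) := by
    rw [← hu]
    exact analyticAt_inverse (𝕜 := ℝ) (A := (ℝ →ᵇ R) →L[ℝ] (ℝ →ᵇ R)) u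
  exact (ContinuousLinearMap.analyticAt (ContinuousLinearMap.apply ℝ (ℝ →ᵇ R)
    (weightedOne R L)) _).comp (hinv.comp hV)

lemma analyticAt_fundamentalSolution (t : ℝ) (A : ℝ →ᵇ R) :
    AnalyticAt ℝ (fun B => fundamentalSolution B t) A := by
  have hL : (0 : ℝ) < ‖A‖ + 1 := by positivity
  have hA : ‖A‖ < ‖A‖ + 1 := lt_add_one _
  refine AnalyticAt.congr ?_ ((fundamentalSolution_eventuallyEq hL hA).fun_comp (· t)).symm
  exact ((Real.cosh ((‖A‖ + 1) * t) • BoundedContinuousFunction.evalCLM ℝ t).analyticAt _).comp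
    (analyticAt_weightedFundamentalSolution hL hA)

lemma continuous_integral_fundamentalSolution (ℓ : R →L[ℝ] ℝ) (g : ℝ →ᵇ ℝ) (t : ℝ) :
    Continuous fun A : ℝ →ᵇ R =>
      ∫ s in (0 : ℝ)..t, ℓ (fundamentalSolution A s) * g s := by
  refine continuous_iff_continuousAt.2 fun A => ?_
  set L := ‖A‖ + 1
  have hL : (0 : ℝ) < L := by positivity
  have hA : ‖A‖ < L := lt_add_one _
  have heq : (fun B : ℝ →ᵇ R => ∫ s in (0 : ℝ)..t, ℓ (fundamentalSolution B s) * g s) =ᶠ[𝓝 A]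
      fun B => Real.cosh (L * t) • weightedPrimitive ℝ hL
        (ℓ.compLeftContinuousBounded ℝ (weightedFundamentalSolution hL B) * g) t := by
    filter_upwards [fundamentalSolution_eventuallyEq hL hA] with B hB
    rw [hB, cosh_smul_weightedPrimitive]
    refine intervalIntegral.integral_congr fun s _ => ?_
    simp [mul_assoc]
  refine ContinuousAt.congr ?_ heq.symm
  have hX : ContinuousAt (fun B => ℓ.compLeftContinuousBounded ℝ
      (weightedFundamentalSolution hL B) * g) A :=
    ((ℓ.compLeftContinuousBounded ℝ).continuous.continuousAt.comp
      (analyticAt_weightedFundamentalSolution hL hA).continuousAt).mul continuousAt_const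
  exact ((Real.cosh (L * t) • (BoundedContinuousFunction.evalCLM ℝ t).comp
    (weightedPrimitive ℝ hL)).continuous.continuousAt).comp hX

end FundamentalSolution

section SturmLiouville

lemma apply_sub_eq_of_periodic_of_even {p : ℝ → ℝ} {T : ℝ} (hp : Function.Periodic p T)
    (hp' : Function.Even p) (t : ℝ) : p (T - t) = p t := by
  rw [hp.sub_eq', hp']

lemma deriv_eq_zero_of_symm {x : ℝ → ℝ} {c : ℝ} (hs : ∀ t, x (2 * c - t) = x t) :
    deriv x c = 0 := by
  have hd := deriv_comp_const_sub (f := x) (a := 2 * c) (x := c)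
  rw [funext hs, two_mul, add_sub_cancel_right] at hd
  linarith

/-- The Sturm–Liouville equation `(p x')' + q x = 0` as a first order system, with `y = p x'`. -/
structure IsSturmLiouvilleSystem (p q x y : ℝ → ℝ) : Prop where
  left : ∀ t, HasDerivAt x (y t / p t) t
  right : ∀ t, HasDerivAt y (-(q t * x t)) t

variable {p q x y x₁ y₁ x₂ y₂ u v : ℝ → ℝ} {T : ℝ}

namespace IsSturmLiouvilleSystem

lemma continuous_left (h : IsSturmLiouvilleSystem p q x y) : Continuous x :=
  continuous_iff_continuousAt.2 fun t => (h.left t).continuousAt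

lemma continuous_right (h : IsSturmLiouvilleSystem p q x y) : Continuous y :=
  continuous_iff_continuousAt.2 fun t => (h.right t).continuousAt

lemma deriv_left (h : IsSturmLiouvilleSystem p q x y) : deriv x = fun t => y t / p t :=
  funext fun t => (h.left t).deriv

lemma wronskian_eq (h : IsSturmLiouvilleSystem p q x y) (h' : IsSturmLiouvilleSystem p q u v)
    (s t : ℝ) : x s * v s - u s * y s = x t * v t - u t * y t := by
  have hd (t : ℝ) : HasDerivAt (fun t => x t * v t - u t * y t) 0 t :=
    (((h.left t).fun_mul (h'.right t)).fun_sub ((h'.left t).fun_mul (h.right t))).congr_deriv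
      (by ring)
  exact is_const_of_deriv_eq_zero (fun t => (hd t).differentiableAt) (fun t => (hd t).deriv) s t

lemma const_mul (h : IsSturmLiouvilleSystem p q x y) (a : ℝ) :
    IsSturmLiouvilleSystem p q (fun t => a * x t) (fun t => a * y t) where
  left t := ((h.left t).const_mul a).congr_deriv (by ring)
  right t := ((h.right t).const_mul a).congr_deriv (by ring)

lemma comp_add_const (h : IsSturmLiouvilleSystem p q x y) {c : ℝ} (hp : Function.Periodic p c)
    (hq : Function.Periodic q c) :
    IsSturmLiouvilleSystem p q (fun t => x (t + c)) (fun t => y (t + c)) where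
  left t := by simpa only [hp t] using (h.left (t + c)).comp_add_const t c
  right t := by simpa only [hq t] using (h.right (t + c)).comp_add_const t c

lemma comp_const_sub (h : IsSturmLiouvilleSystem p q x y) {p' q' : ℝ → ℝ} {c : ℝ}
    (hp : ∀ t, p (c - t) = p' t) (hq : ∀ t, q (c - t) = q' t) :
    IsSturmLiouvilleSystem p' q' (fun t => x (c - t)) (fun t => -y (c - t)) where
  left t := ((h.left (c - t)).comp_const_sub c t).congr_deriv (by rw [hp]; ring)
  right t := (((h.right (c - t)).comp_const_sub c t).fun_neg).congr_deriv (by rw [hq]; ring)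

lemma comp_neg (h : IsSturmLiouvilleSystem p q x y) (hp : Function.Even p)
    (hq : Function.Even q) :
    IsSturmLiouvilleSystem p q (fun t => x (-t)) (fun t => -y (-t)) := by
  simpa only [zero_sub] using
    h.comp_const_sub (c := 0) (by simpa only [zero_sub]) (by simpa only [zero_sub])

end IsSturmLiouvilleSystem

/-- Two solutions of a Sturm–Liouville system with initial values `(1, 0)` and `(0, 1)`. -/
structure IsFundamentalPair (p q x₁ y₁ x₂ y₂ : ℝ → ℝ) : Prop where
  fst : IsSturmLiouvilleSystem p q x₁ y₁
  snd : IsSturmLiouvilleSystem p q x₂ y₂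
  x₁_zero : x₁ 0 = 1
  y₁_zero : y₁ 0 = 0
  x₂_zero : x₂ 0 = 0
  y₂_zero : y₂ 0 = 1

lemma mul_abs_le_abs_of_linear_recurrence {m : ℝ} (hm : 1 ≤ |m|) {s : ℕ → ℝ} (h0 : s 0 = 0)
    (hs : ∀ n, s (n + 2) = 2 * m * s (n + 1) - s n) (n : ℕ) : n * |s 1| ≤ |s n| := by
  have increment (n : ℕ) : |s n| + |s 1| ≤ |s (n + 1)| := by
    induction n with
    | zero => simp [h0]
    | succ n ih =>
      have hupper : |2 * m * s (n + 1)| ≤ |s (n + 2)| + |s n| := by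
        rw [show 2 * m * s (n + 1) = s (n + 2) + s n by rw [hs]; ring]
        exact abs_add_le _ _
      have hlower : 2 * |s (n + 1)| ≤ |2 * m * s (n + 1)| := by
        rw [abs_mul, abs_mul, abs_two]
        gcongr
        linarith
      linarith
  induction n with
  | zero => simp
  | succ n ih =>
    push_cast
    linarith [increment n]

lemma definite_form_invariant {m B C : ℝ} (hdet : m ^ 2 - B * C = 1) (hBC : B * C < 0)
    (u v : ℝ) :
    |C| * (m * u + B * v) ^ 2 + |B| * (C * u + m * v) ^ 2 = |C| * u ^ 2 + |B| * v ^ 2 := by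
  rcases mul_neg_iff.1 hBC with ⟨hB, hC⟩ | ⟨hB, hC⟩
  · rw [abs_of_pos hB, abs_of_neg hC]
    linear_combination (-C * u ^ 2 + B * v ^ 2) * hdet
  · rw [abs_of_neg hB, abs_of_pos hC]
    linear_combination (C * u ^ 2 - B * v ^ 2) * hdet

lemma exists_sq_add_sq_le_of_elliptic {m B C : ℝ} (hdet : m ^ 2 - B * C = 1)
    (hBC : B * C < 0) :
    ∃ R, ∀ u v : ℕ → ℝ, (∀ n, u (n + 1) = m * u n + B * v n) →
      (∀ n, v (n + 1) = C * u n + m * v n) →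
      ∀ n, u n ^ 2 + v n ^ 2 ≤ R * (u 0 ^ 2 + v 0 ^ 2) := by
  have hB : 0 < |B| := abs_pos.2 (left_ne_zero_of_mul hBC.ne)
  have hC : 0 < |C| := abs_pos.2 (right_ne_zero_of_mul hBC.ne)
  refine ⟨(|B| + |C|) / min |B| |C|, fun u v hu hv n => ?_⟩
  have hinv : |C| * u n ^ 2 + |B| * v n ^ 2 = |C| * u 0 ^ 2 + |B| * v 0 ^ 2 := by
    induction n with
    | zero => rfl
    | succ n ih => rw [hu, hv, definite_form_invariant hdet hBC, ih]
  rw [div_mul_eq_mul_div, le_div_iff₀ (lt_min hB hC)]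
  calc (u n ^ 2 + v n ^ 2) * min |B| |C|
      = min |B| |C| * u n ^ 2 + min |B| |C| * v n ^ 2 := by ring
    _ ≤ |C| * u n ^ 2 + |B| * v n ^ 2 := by
      gcongr
      exacts [min_le_right _ _, min_le_left _ _]
    _ = |C| * u 0 ^ 2 + |B| * v 0 ^ 2 := hinv
    _ ≤ (|B| + |C|) * (u 0 ^ 2 + v 0 ^ 2) := by
      nlinarith [mul_nonneg hB.le (sq_nonneg (u 0)), mul_nonneg hC.le (sq_nonneg (v 0))]

namespace IsFundamentalPair

lemma wronskian (h : IsFundamentalPair p q x₁ y₁ x₂ y₂) (t : ℝ) :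
    x₁ t * y₂ t - x₂ t * y₁ t = 1 := by
  rw [h.fst.wronskian_eq h.snd t 0]
  simp [h.x₁_zero, h.y₁_zero, h.x₂_zero, h.y₂_zero]

lemma left_eq (h : IsFundamentalPair p q x₁ y₁ x₂ y₂) (hu : IsSturmLiouvilleSystem p q u v)
    (t : ℝ) : u t = u 0 * x₁ t + v 0 * x₂ t := by
  have h₁ := hu.wronskian_eq h.snd t 0
  have h₂ := h.fst.wronskian_eq hu t 0
  simp only [h.x₁_zero, h.y₁_zero, h.x₂_zero, h.y₂_zero] at h₁ h₂
  linear_combination x₁ t * h₁ + x₂ t * h₂ - u t * h.wronskian t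

lemma right_eq (h : IsFundamentalPair p q x₁ y₁ x₂ y₂) (hu : IsSturmLiouvilleSystem p q u v)
    (t : ℝ) : v t = u 0 * y₁ t + v 0 * y₂ t := by
  have h₁ := hu.wronskian_eq h.snd t 0
  have h₂ := h.fst.wronskian_eq hu t 0
  simp only [h.x₁_zero, h.y₁_zero, h.x₂_zero, h.y₂_zero] at h₁ h₂
  linear_combination y₁ t * h₁ + y₂ t * h₂ - v t * h.wronskian t

lemma exists_sq_add_sq_le_on_Icc (h : IsFundamentalPair p q x₁ y₁ x₂ y₂) (a b : ℝ) :
    ∃ S, 0 ≤ S ∧ ∀ u v, IsSturmLiouvilleSystem p q u v → ∀ t ∈ Set.Icc a b,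
      u t ^ 2 + v t ^ 2 ≤ S * (u 0 ^ 2 + v 0 ^ 2) := by
  have hcont : Continuous fun t => x₁ t ^ 2 + x₂ t ^ 2 + (y₁ t ^ 2 + y₂ t ^ 2) :=
    ((h.fst.continuous_left.pow 2).add (h.snd.continuous_left.pow 2)).add
      ((h.fst.continuous_right.pow 2).add (h.snd.continuous_right.pow 2))
  obtain ⟨S, hS⟩ := (isCompact_Icc (a := a) (b := b)).exists_bound_of_continuousOn
    hcont.continuousOn
  refine ⟨|S|, abs_nonneg S, fun u v hu t ht => ?_⟩
  have cauchySchwarz (a b c d : ℝ) : (a * c + b * d) ^ 2 ≤ (a ^ 2 + b ^ 2) * (c ^ 2 + d ^ 2) := by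
    nlinarith [sq_nonneg (a * d - b * c)]
  calc u t ^ 2 + v t ^ 2
      = (u 0 * x₁ t + v 0 * x₂ t) ^ 2 + (u 0 * y₁ t + v 0 * y₂ t) ^ 2 := by
        rw [h.left_eq hu t, h.right_eq hu t]
    _ ≤ (u 0 ^ 2 + v 0 ^ 2) * (x₁ t ^ 2 + x₂ t ^ 2)
        + (u 0 ^ 2 + v 0 ^ 2) * (y₁ t ^ 2 + y₂ t ^ 2) :=
        add_le_add (cauchySchwarz _ _ _ _) (cauchySchwarz _ _ _ _)
    _ = (x₁ t ^ 2 + x₂ t ^ 2 + (y₁ t ^ 2 + y₂ t ^ 2)) * (u 0 ^ 2 + v 0 ^ 2) := by ring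
    _ ≤ |S| * (u 0 ^ 2 + v 0 ^ 2) := by
        gcongr
        exact (le_abs_self _).trans ((hS t ht).trans (le_abs_self S))

section Symmetric

variable (h : IsFundamentalPair p q x₁ y₁ x₂ y₂) (hp : ∀ t, p (T - t) = p t)
  (hq : ∀ t, q (T - t) = q t)

include h hp hq

lemma y₁_eq_of_symm : y₁ T = 2 * (x₁ (T / 2) * y₁ (T / 2)) := by
  have hw := h.fst.wronskian_eq (h.fst.comp_const_sub hp hq) 0 (T / 2)
  simp only [h.x₁_zero, h.y₁_zero, sub_zero, sub_half] at hw
  linarith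

lemma x₂_eq_of_symm : x₂ T = 2 * (x₂ (T / 2) * y₂ (T / 2)) := by
  have hw := h.snd.wronskian_eq (h.snd.comp_const_sub hp hq) 0 (T / 2)
  simp only [h.x₂_zero, h.y₂_zero, sub_zero, sub_half] at hw
  linarith

lemma y₂_eq_of_symm : y₂ T = 2 * (x₁ (T / 2) * y₂ (T / 2)) - 1 := by
  have hw := h.fst.wronskian_eq (h.snd.comp_const_sub hp hq) 0 (T / 2)
  simp only [h.x₁_zero, h.y₁_zero, sub_zero, sub_half] at hw
  linarith [h.wronskian (T / 2)]

lemma x₁_eq_of_symm : x₁ T = 2 * (x₁ (T / 2) * y₂ (T / 2)) - 1 := by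
  have hw := h.snd.wronskian_eq (h.fst.comp_const_sub hp hq) 0 (T / 2)
  simp only [h.x₂_zero, h.y₂_zero, sub_zero, sub_half] at hw
  linarith [h.wronskian (T / 2)]

lemma y₂_eq_x₁_of_symm : y₂ T = x₁ T := by
  rw [h.y₂_eq_of_symm hp hq, h.x₁_eq_of_symm hp hq]

end Symmetric

section Periodic

variable (h : IsFundamentalPair p q x₁ y₁ x₂ y₂) (hp : Function.Periodic p T)
  (hq : Function.Periodic q T)

include h hp hq

lemma left_add_period (hu : IsSturmLiouvilleSystem p q u v) (t : ℝ) :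
    u (t + T) = u T * x₁ t + v T * x₂ t := by
  simpa only [zero_add] using h.left_eq (hu.comp_add_const hp hq) t

lemma left_iterate (hu : IsSturmLiouvilleSystem p q u v) (n : ℕ) :
    u ((n + 1 : ℕ) * T) = x₁ T * u (n * T) + x₂ T * v (n * T) := by
  have hT := h.left_eq (hu.comp_add_const (hp.nat_mul n) (hq.nat_mul n)) T
  simp only [zero_add] at hT
  rw [Nat.cast_succ, add_one_mul, add_comm, hT]
  ring

lemma right_iterate (hu : IsSturmLiouvilleSystem p q u v) (n : ℕ) :
    v ((n + 1 : ℕ) * T) = y₁ T * u (n * T) + y₂ T * v (n * T) := by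
  have hT := h.right_eq (hu.comp_add_const (hp.nat_mul n) (hq.nat_mul n)) T
  simp only [zero_add] at hT
  rw [Nat.cast_succ, add_one_mul, add_comm, hT]
  ring

lemma exists_sq_add_sq_le_of_multiples (hT : 0 < T) {R : ℝ}
    (hR : ∀ u v, IsSturmLiouvilleSystem p q u v → ∀ n : ℕ,
      u (n * T) ^ 2 + v (n * T) ^ 2 ≤ R * (u 0 ^ 2 + v 0 ^ 2)) :
    ∃ S, ∀ u v, IsSturmLiouvilleSystem p q u v → ∀ t, 0 ≤ t →
      u t ^ 2 + v t ^ 2 ≤ S * (u 0 ^ 2 + v 0 ^ 2) := by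
  obtain ⟨S, hS0, hS⟩ := h.exists_sq_add_sq_le_on_Icc 0 T
  refine ⟨S * R, fun u v hu t ht => ?_⟩
  set n := ⌊t / T⌋₊
  have hs : t - n * T ∈ Set.Icc 0 T := by
    have hlow := (le_div_iff₀ hT).1 (Nat.floor_le (div_nonneg ht hT.le))
    have hhigh := (div_lt_iff₀ hT).1 (Nat.lt_floor_add_one (t / T))
    exact ⟨by linarith, by linarith⟩
  have hshift := hS _ _ (hu.comp_add_const (hp.nat_mul n) (hq.nat_mul n)) _ hs
  simp only [sub_add_cancel, zero_add] at hshift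
  calc u t ^ 2 + v t ^ 2 ≤ S * (u (n * T) ^ 2 + v (n * T) ^ 2) := hshift
    _ ≤ S * (R * (u 0 ^ 2 + v 0 ^ 2)) := mul_le_mul_of_nonneg_left (hR u v hu n) hS0
    _ = S * R * (u 0 ^ 2 + v 0 ^ 2) := by ring

lemma left_second_order_recurrence (hd : y₂ T = x₁ T) (hu : IsSturmLiouvilleSystem p q u v)
    (n : ℕ) : u ((n + 2 : ℕ) * T) = 2 * x₁ T * u ((n + 1 : ℕ) * T) - u (n * T) := by
  have hw := h.wronskian T
  rw [hd] at hw
  rw [h.left_iterate hp hq hu (n + 1), h.right_iterate hp hq hu n, hd]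
  linear_combination (-x₁ T) * h.left_iterate hp hq hu n - u (n * T) * hw

lemma right_second_order_recurrence (hd : y₂ T = x₁ T) (hu : IsSturmLiouvilleSystem p q u v)
    (n : ℕ) : v ((n + 2 : ℕ) * T) = 2 * x₁ T * v ((n + 1 : ℕ) * T) - v (n * T) := by
  have hw := h.wronskian T
  rw [hd] at hw
  rw [h.right_iterate hp hq hu (n + 1), h.left_iterate hp hq hu n, hd]
  linear_combination (-x₁ T) * h.right_iterate hp hq hu n - x₁ T * v (n * T) * hd
    - v (n * T) * hw

end Periodic

section EvenPeriodic

variable (h : IsFundamentalPair p q x₁ y₁ x₂ y₂) (hp : Function.Periodic p T)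
  (hq : Function.Periodic q T) (hp' : Function.Even p) (hq' : Function.Even q)

include h hp hq hp' hq'

lemma exists_sq_add_sq_le_of_pos (hT : 0 < T) (hpos : 0 < x₁ (T / 2) * y₂ (T / 2))
    (hlt : x₁ (T / 2) * y₂ (T / 2) < 1) :
    ∃ S, ∀ u v, IsSturmLiouvilleSystem p q u v → ∀ t, 0 ≤ t →
      u t ^ 2 + v t ^ 2 ≤ S * (u 0 ^ 2 + v 0 ^ 2) := by
  have hsp := apply_sub_eq_of_periodic_of_even hp hp'
  have hsq := apply_sub_eq_of_periodic_of_even hq hq'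
  have hd := h.y₂_eq_x₁_of_symm hsp hsq
  have hdet : x₁ T ^ 2 - x₂ T * y₁ T = 1 := by
    linear_combination h.wronskian T - x₁ T * hd
  have hneg : x₂ T * y₁ T < 0 := by
    rw [h.x₂_eq_of_symm hsp hsq, h.y₁_eq_of_symm hsp hsq]
    nlinarith [h.wronskian (T / 2)]
  obtain ⟨R, hR⟩ := exists_sq_add_sq_le_of_elliptic hdet hneg
  refine h.exists_sq_add_sq_le_of_multiples hp hq hT (R := R) fun u v hu n => ?_
  simpa using hR (fun n => u (n * T)) (fun n => v (n * T)) (fun n => h.left_iterate hp hq hu n)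
    (fun n => hd ▸ h.right_iterate hp hq hu n) n

lemma exists_sq_add_sq_le_of_eq_zero (hT : 0 < T) (hx : x₁ (T / 2) = 0) (hy : y₂ (T / 2) = 0) :
    ∃ S, ∀ u v, IsSturmLiouvilleSystem p q u v → ∀ t, 0 ≤ t →
      u t ^ 2 + v t ^ 2 ≤ S * (u 0 ^ 2 + v 0 ^ 2) := by
  have hsp := apply_sub_eq_of_periodic_of_even hp hp'
  have hsq := apply_sub_eq_of_periodic_of_even hq hq'
  refine h.exists_sq_add_sq_le_of_multiples hp hq hT (R := 1) fun u v hu n => ?_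
  induction n with
  | zero => simp
  | succ n ih =>
    rw [h.left_iterate hp hq hu, h.right_iterate hp hq hu, h.y₂_eq_of_symm hsp hsq,
      h.x₂_eq_of_symm hsp hsq, h.y₁_eq_of_symm hsp hsq, h.x₁_eq_of_symm hsp hsq, hx, hy]
    simpa using ih

lemma exists_unbounded (hle : x₁ (T / 2) * y₂ (T / 2) ≤ 0)
    (hne : ¬ (x₁ (T / 2) = 0 ∧ y₂ (T / 2) = 0)) :
    ∃ u v, IsSturmLiouvilleSystem p q u v ∧ ∀ R, ∃ n : ℕ, R < |u (n * T)| ∨ R < |v (n * T)| := by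
  have hsp := apply_sub_eq_of_periodic_of_even hp hp'
  have hsq := apply_sub_eq_of_periodic_of_even hq hq'
  have hd := h.y₂_eq_x₁_of_symm hsp hsq
  have hm : 1 ≤ |x₁ T| := by
    rw [h.x₁_eq_of_symm hsp hsq]
    exact le_abs.2 (Or.inr (by linarith))
  have hoff : x₂ (T / 2) * y₁ (T / 2) ≠ 0 := fun h0 => by linarith [h.wronskian (T / 2)]
  have unbounded {s : ℕ → ℝ} (h0 : s 0 = 0) (h1 : s 1 ≠ 0)
      (hs : ∀ n, s (n + 2) = 2 * x₁ T * s (n + 1) - s n) (R : ℝ) : ∃ n, R < |s n| := by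
    obtain ⟨n, hn⟩ := exists_nat_gt (R / |s 1|)
    exact ⟨n, ((div_lt_iff₀ (abs_pos.2 h1)).1 hn).trans_le
      (mul_abs_le_abs_of_linear_recurrence hm h0 hs n)⟩
  by_cases hy : y₂ (T / 2) = 0
  · have hx : x₁ (T / 2) ≠ 0 := fun hx => hne ⟨hx, hy⟩
    refine ⟨x₁, y₁, h.fst, fun R => ?_⟩
    obtain ⟨n, hn⟩ := unbounded (s := fun n => y₁ (n * T)) (by simp [h.y₁_zero])
      (by simp [h.y₁_eq_of_symm hsp hsq, hx, right_ne_zero_of_mul hoff])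
      (fun n => h.right_second_order_recurrence hp hq hd h.fst n) R
    exact ⟨n, Or.inr hn⟩
  · refine ⟨x₂, y₂, h.snd, fun R => ?_⟩
    obtain ⟨n, hn⟩ := unbounded (s := fun n => x₂ (n * T)) (by simp [h.x₂_zero])
      (by simp [h.x₂_eq_of_symm hsp hsq, hy, left_ne_zero_of_mul hoff])
      (fun n => h.left_second_order_recurrence hp hq hd h.snd n) R
    exact ⟨n, Or.inl hn⟩

lemma exists_even_periodic_iff (hp0 : p 0 ≠ 0) (hy₁ : y₁ (T / 2) ≠ 0) :
    (∃ u v, IsSturmLiouvilleSystem p q u v ∧ u ≠ 0 ∧ Function.Periodic u (2 * T) ∧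
      Function.Even u) ↔ x₁ (T / 2) = 0 := by
  have hsp := apply_sub_eq_of_periodic_of_even hp hp'
  have hsq := apply_sub_eq_of_periodic_of_even hq hq'
  constructor
  · rintro ⟨u, v, hu, hne, hper, heven⟩
    have right_eq_zero {c : ℝ} (hc : p c = p 0) (hsymm : ∀ t, u (2 * c - t) = u t) : v c = 0 := by
      have hder : v c / p c = 0 := (hu.left c).deriv.symm.trans (deriv_eq_zero_of_symm hsymm)
      exact (div_eq_zero_iff.1 hder).resolve_right (hc ▸ hp0)
    have hv0 : v 0 = 0 := right_eq_zero rfl fun t => by rw [mul_zero, zero_sub, heven]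
    have hvT : v T = 0 := right_eq_zero hp.eq fun t => by rw [hper.sub_eq', heven]
    have hu0 : u 0 ≠ 0 := fun h0 => hne (funext fun t => by simp [h.left_eq hu t, h0, hv0])
    have hy : u 0 * y₁ T = 0 := by simpa [hv0, hvT] using (h.right_eq hu T).symm
    rw [h.y₁_eq_of_symm hsp hsq] at hy
    simpa [hu0, hy₁] using hy
  · intro hx
    have hanti : Function.Antiperiodic x₁ T := fun t => by
      rw [h.left_add_period hp hq h.fst, h.y₁_eq_of_symm hsp hsq, h.x₁_eq_of_symm hsp hsq, hx]
      ring
    refine ⟨x₁, y₁, h.fst, fun h0 => ?_, by simpa using hanti.periodic_two_mul, fun t => ?_⟩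
    · simpa [h0] using h.x₁_zero
    · simpa [h.x₁_zero, h.y₁_zero] using h.left_eq (h.fst.comp_neg hp' hq') t

lemma exists_odd_periodic_iff (hp0 : p 0 ≠ 0) (hx₂ : x₂ (T / 2) ≠ 0) :
    (∃ u v, IsSturmLiouvilleSystem p q u v ∧ u ≠ 0 ∧ Function.Periodic u (2 * T) ∧
      Function.Odd u) ↔ y₂ (T / 2) = 0 := by
  have hsp := apply_sub_eq_of_periodic_of_even hp hp'
  have hsq := apply_sub_eq_of_periodic_of_even hq hq'
  constructor
  · rintro ⟨u, v, hu, hne, hper, hodd⟩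
    have hu0 : u 0 = 0 := hodd.map_zero
    have huT : u T = 0 := by
      have hneg := hper.sub_eq' (x := T)
      rw [hodd, two_mul, add_sub_cancel_right] at hneg
      linarith
    have hv0 : v 0 ≠ 0 := fun h0 => hne (funext fun t => by simp [h.left_eq hu t, hu0, h0])
    have hx : v 0 * x₂ T = 0 := by simpa [hu0, huT] using (h.left_eq hu T).symm
    rw [h.x₂_eq_of_symm hsp hsq] at hx
    simpa [hv0, hx₂] using hx
  · intro hy
    have hanti : Function.Antiperiodic x₂ T := fun t => by
      rw [h.left_add_period hp hq h.snd, h.x₂_eq_of_symm hsp hsq, h.y₂_eq_of_symm hsp hsq, hy]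
      ring
    refine ⟨x₂, y₂, h.snd, fun h0 => ?_, by simpa using hanti.periodic_two_mul, fun t => ?_⟩
    · have hder := (h.snd.left 0).deriv
      exact hp0 (by simpa [h0, h.y₂_zero, eq_comm] using hder)
    · have hneg := h.left_eq (h.snd.comp_neg hp' hq') t
      simp only [neg_zero, h.x₂_zero, h.y₂_zero] at hneg
      linarith

end EvenPeriodic

end IsFundamentalPair

end SturmLiouville

section Ladder

/-- `|u|` decays geometrically with ratio `r` on both sides of the index `K`. -/
structure IsPeakedAt (r : ℝ) (K : ℕ) (u : ℕ → ℝ) : Prop where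
  head : ∀ j < K, |u j| ≤ r * |u (j + 1)|
  tail : ∀ j, K ≤ j → |u (j + 1)| ≤ r * |u j|

namespace IsPeakedAt

variable {r r' : ℝ} {K : ℕ} {u w : ℕ → ℝ}

lemma mul (hu : IsPeakedAt r K u) (hw : IsPeakedAt r' K w) :
    IsPeakedAt (r * r') K fun j => u j * w j where
  head j hj := by
    rw [abs_mul, abs_mul, mul_mul_mul_comm]
    exact mul_le_mul (hu.head j hj) (hw.head j hj) (abs_nonneg _)
      ((abs_nonneg _).trans (hu.head j hj))
  tail j hj := by
    rw [abs_mul, abs_mul, mul_mul_mul_comm]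
    exact mul_le_mul (hu.tail j hj) (hw.tail j hj) (abs_nonneg _)
      ((abs_nonneg _).trans (hu.tail j hj))

lemma mono (hu : IsPeakedAt r K u) (h : r ≤ r') : IsPeakedAt r' K u where
  head j hj := (hu.head j hj).trans (mul_le_mul_of_nonneg_right h (abs_nonneg _))
  tail j hj := (hu.tail j hj).trans (mul_le_mul_of_nonneg_right h (abs_nonneg _))

lemma abs_zero_le (hu : IsPeakedAt r K u) (hr : 0 ≤ r) : |u 0| ≤ r ^ K * |u K| := by
  have h (n : ℕ) (hn : n ≤ K) : |u 0| ≤ r ^ n * |u n| := by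
    induction n with
    | zero => simp
    | succ n ih =>
      calc |u 0| ≤ r ^ n * |u n| := ih (by omega)
        _ ≤ r ^ n * (r * |u (n + 1)|) := by
          gcongr
          exact hu.head n hn
        _ = r ^ (n + 1) * |u (n + 1)| := by ring
  exact h K le_rfl

lemma abs_add_le (hu : IsPeakedAt r K u) (hr : 0 ≤ r) (i : ℕ) :
    |u (i + K)| ≤ r ^ i * |u K| := by
  induction i with
  | zero => simp
  | succ i ih =>
    calc |u (i + 1 + K)| ≤ r * |u (i + K)| := by
          rw [add_right_comm]
          exact hu.tail _ (by omega)
      _ ≤ r * (r ^ i * |u K|) := by gcongr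
      _ = r ^ (i + 1) * |u K| := by ring

lemma summable (hu : IsPeakedAt r K u) (hr0 : 0 ≤ r) (hr : r < 1) : Summable u :=
  (summable_nat_add_iff K).1 <| Summable.of_norm_bounded
    ((summable_geometric_of_lt_one hr0 hr).mul_right _) (hu.abs_add_le hr0)

lemma sum_head_le (hu : IsPeakedAt r K u) (hr0 : 0 ≤ r) (hr : r < 1) :
    ∑ j ∈ Finset.range K, |u j| ≤ r / (1 - r) * |u K| := by
  have hr' : 0 < 1 - r := sub_pos.2 hr
  have h (n : ℕ) (hn : n ≤ K) : (1 - r) * ∑ j ∈ Finset.range n, |u j| ≤ r * |u n| := by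
    induction n with
    | zero => simpa using mul_nonneg hr0 (abs_nonneg (u 0))
    | succ n ih =>
      rw [Finset.sum_range_succ, mul_add]
      linarith [ih (by omega), hu.head n hn]
  rw [div_mul_eq_mul_div, le_div_iff₀' hr']
  exact h K le_rfl

lemma abs_tsum_tail_le (hu : IsPeakedAt r K u) (hr0 : 0 ≤ r) (hr : r < 1) :
    |∑' i, u (i + (K + 1))| ≤ r / (1 - r) * |u K| := by
  have hgeom : HasSum (fun i => r ^ (i + 1) * |u K|) (r / (1 - r) * |u K|) := by
    simpa only [pow_succ', div_eq_mul_inv] using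
      ((hasSum_geometric_of_lt_one hr0 hr).mul_left r).mul_right |u K|
  rw [← Real.norm_eq_abs (∑' i, u (i + (K + 1)))]
  refine tsum_of_norm_bounded hgeom fun i => ?_
  rw [Real.norm_eq_abs, ← add_assoc, add_right_comm]
  exact hu.abs_add_le hr0 (i + 1)

lemma abs_tsum_sub_le (hu : IsPeakedAt r K u) (hr0 : 0 ≤ r) (hr : r < 1) :
    |∑' j, u j - u K| ≤ 2 * r / (1 - r) * |u K| := by
  have hsplit : ∑' j, u j - u K = ∑ j ∈ Finset.range K, u j + ∑' i, u (i + (K + 1)) := by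
    rw [← (hu.summable hr0 hr).sum_add_tsum_nat_add (K + 1), Finset.sum_range_succ]
    ring
  rw [hsplit]
  calc |∑ j ∈ Finset.range K, u j + ∑' i, u (i + (K + 1))|
      ≤ ∑ j ∈ Finset.range K, |u j| + |∑' i, u (i + (K + 1))| :=
        (_root_.abs_add_le _ _).trans (add_le_add_left (Finset.abs_sum_le_sum_abs _ _) _)
    _ ≤ r / (1 - r) * |u K| + r / (1 - r) * |u K| :=
        add_le_add (hu.sum_head_le hr0 hr) (hu.abs_tsum_tail_le hr0 hr)
    _ = 2 * r / (1 - r) * |u K| := by ring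

lemma abs_le_three_mul_abs_tsum (hu : IsPeakedAt (1 / 2 * (1 / 2)) K u) :
    |u K| ≤ 3 * |∑' j, u j| := by
  have h := hu.abs_tsum_sub_le (by norm_num) (by norm_num)
  norm_num at h
  linarith [abs_sub_abs_le_abs_sub (u K) (∑' j, u j), abs_sub_comm (∑' j, u j) (u K)]

lemma abs_tsum_le_two_mul_abs (hu : IsPeakedAt (1 / 2 * (1 / 2)) K u) :
    |∑' j, u j| ≤ 2 * |u K| := by
  have h := hu.abs_tsum_sub_le (by norm_num) (by norm_num)
  norm_num at h
  linarith [abs_sub_abs_le_abs_sub (∑' j, u j) (u K), abs_nonneg (u K)]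

end IsPeakedAt

lemma le_two_mul_of_bounded_recurrence {a : ℕ → ℝ} {ρ : ℝ} (hρ0 : 0 ≤ ρ) (hρ : ρ ≤ 1 / 4)
    (ha : ∀ j, 0 ≤ a j) (hb : BddAbove (Set.range a))
    (h : ∀ j, a (j + 1) ≤ ρ * (a (j + 2) + a j)) : a 1 ≤ 2 * ρ * a 0 := by
  have hb' : BddAbove (Set.range fun i => a (i + 1)) :=
    hb.mono (Set.range_comp_subset_range (· + 1) a)
  set S := ⨆ i, a (i + 1)
  have hle (i : ℕ) : a (i + 1) ≤ S := le_ciSup hb' i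
  have hsup : S ≤ ρ * (2 * S + a 0) := ciSup_le fun i => by
    refine (h i).trans (mul_le_mul_of_nonneg_left ?_ hρ0)
    rcases i with _ | i
    · linarith [hle 1, (ha 1).trans (hle 0)]
    · linarith [hle i, hle (i + 2), ha 0]
  nlinarith [hle 0, mul_le_mul_of_nonneg_right hρ ((ha 1).trans (hle 0))]

/-- `z` solves the three-term recurrence `d j z j + g (z (j + 1) + z (j - 1)) = 0`, closed at
`j = 0` by `g z (-1) = s z 0`. -/
structure IsLadder (d : ℕ → ℝ) (g s : ℝ) (z : ℕ → ℝ) : Prop where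
  zero : (d 0 + s) * z 0 + g * z 1 = 0
  succ : ∀ j, d (j + 1) * z (j + 1) + g * (z (j + 2) + z j) = 0

namespace IsLadder

variable {d : ℕ → ℝ} {g s c C : ℝ} {z : ℕ → ℝ} {K : ℕ}

lemma alternate (h : IsLadder d (-g) s z) : IsLadder d g s fun j => (-1) ^ j * z j where
  zero := by linear_combination h.zero
  succ j := by
    rw [pow_add _ j 2, pow_succ]
    linear_combination -(-1) ^ j * h.succ j

lemma abs_zero_eq (h : IsLadder d g s z) : |d 0 + s| * |z 0| = |g| * |z 1| := by
  rw [← abs_mul, ← abs_mul, eq_neg_of_add_eq_zero_left h.zero, abs_neg]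

lemma abs_succ_eq (h : IsLadder d g s z) (j : ℕ) :
    |d (j + 1)| * |z (j + 1)| = |g| * |z (j + 2) + z j| := by
  rw [← abs_mul, ← abs_mul, eq_neg_of_add_eq_zero_left (h.succ j), abs_neg]

lemma abs_succ_le (h : IsLadder d g s z) (j : ℕ) :
    |d (j + 1)| * |z (j + 1)| ≤ |g| * (|z (j + 2)| + |z j|) := by
  rw [h.abs_succ_eq]
  exact mul_le_mul_of_nonneg_left (abs_add_le _ _) (abs_nonneg g)

lemma tail_le (h : IsLadder d g s z) (hz : BddAbove (Set.range fun j => |z j|)) (hc : 0 < c)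
    (hg : |g| ≤ c / 4) (hd : ∀ j, K < j → c ≤ |d j|) {j : ℕ} (hj : K ≤ j) :
    |z (j + 1)| ≤ 2 * |g| / c * |z j| := by
  have hρ : |g| / c ≤ 1 / 4 := by rwa [div_le_iff₀ hc, one_div_mul_eq_div]
  have hrec (i : ℕ) : |z (i + 1 + j)| ≤ |g| / c * (|z (i + 2 + j)| + |z (i + j)|) := by
    rw [div_mul_eq_mul_div, le_div_iff₀' hc, add_right_comm i 1 j, add_right_comm i 2 j]
    exact (mul_le_mul_of_nonneg_right (hd _ (by omega)) (abs_nonneg _)).trans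
      (h.abs_succ_le (i + j))
  have hbdd : BddAbove (Set.range fun i => |z (i + j)|) :=
    hz.mono (Set.range_comp_subset_range (· + j) fun j => |z j|)
  have hle := le_two_mul_of_bounded_recurrence (div_nonneg (abs_nonneg g) hc.le) hρ
    (fun i => abs_nonneg (z (i + j))) hbdd hrec
  rwa [zero_add, add_comm 1 j, ← mul_div_assoc] at hle

lemma head_le (h : IsLadder d g s z) (hs : |s| = |g|) (hc : 0 < c) (hg : |g| ≤ c / 4)
    (hd : ∀ j < K, c ≤ |d j|) {j : ℕ} (hj : j < K) : |z j| ≤ 2 * |g| / c * |z (j + 1)| := by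
  suffices c / 2 * |z j| ≤ |g| * |z (j + 1)| by
    rw [div_mul_eq_mul_div, le_div_iff₀' hc]
    linarith
  induction j with
  | zero =>
    rw [zero_add, ← h.abs_zero_eq]
    gcongr
    have hsub := abs_sub_abs_le_abs_sub (d 0) (-s)
    rw [abs_neg, sub_neg_eq_add] at hsub
    linarith [hd 0 hj]
  | succ j ih =>
    have hprev : |g| * |z j| ≤ c / 2 * |z (j + 1)| :=
      calc |g| * |z j| ≤ c / 2 * |z j| := by gcongr; linarith
        _ ≤ |g| * |z (j + 1)| := ih (by omega)
        _ ≤ c / 2 * |z (j + 1)| := by gcongr; linarith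
    have hdiag := mul_le_mul_of_nonneg_right (hd (j + 1) hj) (abs_nonneg (z (j + 1)))
    linarith [h.abs_succ_le j]

lemma isPeakedAt (h : IsLadder d g s z) (hz : BddAbove (Set.range fun j => |z j|))
    (hs : |s| = |g|) (hc : 0 < c) (hg : |g| ≤ c / 4) (hd : ∀ j, j ≠ K → c ≤ |d j|) :
    IsPeakedAt (2 * |g| / c) K z where
  head _ hj := h.head_le hs hc hg (fun j hj => hd j hj.ne) hj
  tail _ hj := h.tail_le hz hc hg (fun j hj => hd j hj.ne') hj

lemma mul_abs_succ_le (h : IsLadder d g s z) (hs : |s| = |g|) (hc : 0 < c) (hg : |g| ≤ c / 4)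
    (hd : ∀ j < K, c ≤ |d j|) (hC : ∀ j < K, |d j| ≤ C) {j : ℕ} (hj : j < K) :
    |g| * |z (j + 1)| ≤ 2 * C * |z j| := by
  have hgC : |g| ≤ C := by linarith [hd j hj, hC j hj]
  rcases j with _ | j
  · rw [zero_add, ← h.abs_zero_eq]
    gcongr
    exact (abs_add_le _ _).trans (by linarith [hC 0 hj])
  · have hprev : |z j| ≤ |z (j + 1)| := by
      refine (h.head_le hs hc hg hd (by omega)).trans
        (mul_le_of_le_one_left (abs_nonneg _) ((div_le_one hc).2 ?_))
      linarith
    have htriangle : |z (j + 2)| ≤ |z (j + 2) + z j| + |z j| := by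
      simpa using abs_sub (z (j + 2) + z j) (z j)
    calc |g| * |z (j + 2)| ≤ |g| * (|z (j + 2) + z j| + |z j|) := by gcongr
      _ = |d (j + 1)| * |z (j + 1)| + |g| * |z j| := by rw [mul_add, h.abs_succ_eq]
      _ ≤ C * |z (j + 1)| + C * |z (j + 1)| := by
          gcongr
          · exact hC _ hj
          · exact (abs_nonneg g).trans hgC
      _ = 2 * C * |z (j + 1)| := by ring

lemma pow_mul_abs_le (h : IsLadder d g s z) (hs : |s| = |g|) (hc : 0 < c) (hg : |g| ≤ c / 4)
    (hd : ∀ j < K, c ≤ |d j|) (hC : ∀ j < K, |d j| ≤ C) :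
    |g| ^ K * |z K| ≤ (2 * C) ^ K * |z 0| := by
  have pow_le (n : ℕ) (hn : n ≤ K) : |g| ^ n * |z n| ≤ (2 * C) ^ n * |z 0| := by
    induction n with
    | zero => simp
    | succ n ih =>
      have hC0 : 0 ≤ C := (abs_nonneg _).trans (hC n hn)
      calc |g| ^ (n + 1) * |z (n + 1)| = |g| ^ n * (|g| * |z (n + 1)|) := by ring
        _ ≤ |g| ^ n * (2 * C * |z n|) :=
          mul_le_mul_of_nonneg_left (h.mul_abs_succ_le hs hc hg hd hC hn) (by positivity)
        _ = 2 * C * (|g| ^ n * |z n|) := by ring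
        _ ≤ 2 * C * ((2 * C) ^ n * |z 0|) :=
          mul_le_mul_of_nonneg_left (ih (by omega)) (by positivity)
        _ = (2 * C) ^ (n + 1) * |z 0| := by ring
  exact pow_le K le_rfl

variable {κ : ℕ → ℝ} {θ θ' : ℝ} {w : ℕ → ℝ}

lemma lagrange_sum (hz : IsLadder (fun j => θ - κ j) g (-g) z)
    (hw : IsLadder (fun j => θ' - κ j) g g w) (N : ℕ) :
    (θ - θ') * ∑ j ∈ Finset.range (N + 1), z j * w j
      + g * (z (N + 1) * w N - w (N + 1) * z N) = 2 * g * (z 0 * w 0) := by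
  induction N with
  | zero =>
    rw [zero_add, Finset.sum_range_one]
    linear_combination w 0 * hz.zero - z 0 * hw.zero
  | succ N ih =>
    rw [Finset.sum_range_succ]
    linear_combination ih + w (N + 1) * hz.succ N - z (N + 1) * hw.succ N

lemma lagrange_tsum (hz : IsLadder (fun j => θ - κ j) g (-g) z)
    (hw : IsLadder (fun j => θ' - κ j) g g w) {r : ℝ} (hzp : IsPeakedAt r K z)
    (hwp : IsPeakedAt r K w) (hr0 : 0 ≤ r) (hr : r < 1) :
    (θ - θ') * ∑' j, z j * w j = 2 * g * (z 0 * w 0) := by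
  have hsum : Summable fun j => z j * w j :=
    (hzp.mul hwp).summable (mul_nonneg hr0 hr0) (mul_lt_one_of_nonneg_of_lt_one_left hr0 hr hr.le)
  have hboundary : Filter.Tendsto (fun N => z (N + 1) * w N - w (N + 1) * z N) Filter.atTop
      (𝓝 0) := by
    have hterm := (hsum.tendsto_atTop_zero.abs.const_mul 2)
    rw [abs_zero, mul_zero] at hterm
    refine squeeze_zero_norm' ?_ hterm
    filter_upwards [Filter.eventually_ge_atTop K] with N hN
    have hzN := (hzp.tail N hN).trans (mul_le_of_le_one_left (abs_nonneg _) hr.le)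
    have hwN := (hwp.tail N hN).trans (mul_le_of_le_one_left (abs_nonneg _) hr.le)
    calc ‖z (N + 1) * w N - w (N + 1) * z N‖
        ≤ |z (N + 1)| * |w N| + |w (N + 1)| * |z N| := by
          rw [← abs_mul, ← abs_mul]
          exact abs_sub _ _
      _ ≤ |z N| * |w N| + |w N| * |z N| := by gcongr
      _ = 2 * |z N * w N| := by rw [abs_mul]; ring
  have hlim := ((hsum.hasSum.tendsto_sum_nat.comp (Filter.tendsto_add_atTop_nat 1)).const_mul
    (θ - θ')).add (hboundary.const_mul g)
  rw [mul_zero, add_zero] at hlim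
  exact tendsto_nhds_unique hlim (by simp [lagrange_sum hz hw])

lemma abs_mul_abs_tsum (hz : IsLadder (fun j => θ - κ j) g (-g) z)
    (hw : IsLadder (fun j => θ' - κ j) g g w) {r : ℝ} (hzp : IsPeakedAt r K z)
    (hwp : IsPeakedAt r K w) (hr0 : 0 ≤ r) (hr : r < 1) :
    |θ - θ'| * |∑' j, z j * w j| = 2 * |g| * |z 0 * w 0| := by
  rw [← abs_mul, lagrange_tsum hz hw hzp hwp hr0 hr, abs_mul, abs_mul, abs_two]

lemma gap_le (hz : IsLadder (fun j => θ - κ j) g (-g) z)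
    (hw : IsLadder (fun j => θ' - κ j) g g w) (hzb : BddAbove (Set.range fun j => |z j|))
    (hwb : BddAbove (Set.range fun j => |w j|)) (hzK : z K ≠ 0) (hwK : w K ≠ 0)
    (hc : 0 < c) (hg : |g| ≤ c / 4) (hθ : ∀ j, j ≠ K → c ≤ |θ - κ j|)
    (hθ' : ∀ j, j ≠ K → c ≤ |θ' - κ j|) :
    |θ - θ'| ≤ 6 * (2 / c) ^ (2 * K) * |g| ^ (2 * K + 1) := by
  have hr0 : 0 ≤ 2 * |g| / c := by positivity
  have hr : 2 * |g| / c ≤ 1 / 2 := by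
    rw [div_le_iff₀ hc]
    linarith
  have hzp := hz.isPeakedAt hzb (abs_neg g) hc hg hθ
  have hwp := hw.isPeakedAt hwb rfl hc hg hθ'
  have hlow := ((hzp.mono hr).mul (hwp.mono hr)).abs_le_three_mul_abs_tsum
  have hbottom : |z 0 * w 0| ≤ (2 * |g| / c) ^ (2 * K) * |z K * w K| := by
    rw [pow_mul, sq]
    exact (hzp.mul hwp).abs_zero_le (mul_nonneg hr0 hr0)
  refine le_of_mul_le_mul_right ?_ (abs_pos.2 (mul_ne_zero hzK hwK))
  calc |θ - θ'| * |z K * w K| ≤ |θ - θ'| * (3 * |∑' j, z j * w j|) := by gcongr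
    _ = 6 * |g| * |z 0 * w 0| := by
      rw [mul_left_comm, abs_mul_abs_tsum hz hw hzp hwp hr0 (by linarith)]
      ring
    _ ≤ 6 * |g| * ((2 * |g| / c) ^ (2 * K) * |z K * w K|) := by gcongr
    _ = 6 * (2 / c) ^ (2 * K) * |g| ^ (2 * K + 1) * |z K * w K| := by
      rw [mul_div_right_comm, mul_pow]
      ring

lemma pow_le_gap (hz : IsLadder (fun j => θ - κ j) g (-g) z)
    (hw : IsLadder (fun j => θ' - κ j) g g w) (hzb : BddAbove (Set.range fun j => |z j|))
    (hwb : BddAbove (Set.range fun j => |w j|)) (hzK : z K ≠ 0) (hwK : w K ≠ 0)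
    (hc : 0 < c) (hg : |g| ≤ c / 4) (hθ : ∀ j, j ≠ K → c ≤ |θ - κ j| ∧ |θ - κ j| ≤ C)
    (hθ' : ∀ j, j ≠ K → c ≤ |θ' - κ j| ∧ |θ' - κ j| ≤ C) :
    |g| ^ (2 * K + 1) ≤ (2 * C) ^ (2 * K) * |θ - θ'| := by
  have hr : 2 * |g| / c ≤ 1 / 2 := by
    rw [div_le_iff₀ hc]
    linarith
  have hzp := hz.isPeakedAt hzb (abs_neg g) hc hg fun j hj => (hθ j hj).1
  have hwp := hw.isPeakedAt hwb rfl hc hg fun j hj => (hθ' j hj).1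
  have hup := ((hzp.mono hr).mul (hwp.mono hr)).abs_tsum_le_two_mul_abs
  have hpow : 0 ≤ (2 * C) ^ (2 * K) := (even_two_mul K).pow_nonneg _
  have htop : |g| ^ (2 * K) * |z K * w K| ≤ (2 * C) ^ (2 * K) * |z 0 * w 0| := by
    have hzC := hz.pow_mul_abs_le (abs_neg g) hc hg (fun j hj => (hθ j hj.ne).1)
      fun j hj => (hθ j hj.ne).2
    have hwC := hw.pow_mul_abs_le rfl hc hg (fun j hj => (hθ' j hj.ne).1)
      fun j hj => (hθ' j hj.ne).2
    rw [two_mul K, pow_add, pow_add, abs_mul, abs_mul, mul_mul_mul_comm,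
      mul_mul_mul_comm _ _ |z 0|]
    exact mul_le_mul hzC hwC (by positivity) ((by positivity : (0 : ℝ) ≤ _).trans hzC)
  refine le_of_mul_le_mul_right ?_ (abs_pos.2 (mul_ne_zero hzK hwK))
  calc |g| ^ (2 * K + 1) * |z K * w K| = |g| * (|g| ^ (2 * K) * |z K * w K|) := by ring
    _ ≤ |g| * ((2 * C) ^ (2 * K) * |z 0 * w 0|) := by gcongr
    _ = (2 * C) ^ (2 * K) * (|θ - θ'| * |∑' j, z j * w j|) / 2 := by
      rw [abs_mul_abs_tsum hz hw hzp hwp (by positivity) (by linarith)]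
      ring
    _ ≤ (2 * C) ^ (2 * K) * (|θ - θ'| * (2 * |z K * w K|)) / 2 := by gcongr
    _ = (2 * C) ^ (2 * K) * |θ - θ'| * |z K * w K| := by ring

end IsLadder

lemma eventually_bounds_abs_sub {α : Type*} {l : Filter α} {κ : ℕ → ℝ} {K : ℕ} {c C : ℝ}
    {θ : α → ℝ} (hc : 0 < c) (hκ : ∀ j, j ≠ K → c ≤ |κ j - κ K| ∧ |κ j - κ K| ≤ C)
    (hθ : Filter.Tendsto θ l (𝓝 (κ K))) :
    ∀ᶠ i in l, ∀ j, j ≠ K → c / 2 ≤ |θ i - κ j| ∧ |θ i - κ j| ≤ C + c / 2 := by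
  filter_upwards [Metric.tendsto_nhds.1 hθ (c / 2) (half_pos hc)] with i hi j hj
  rw [Real.dist_eq] at hi
  have hlow := abs_sub_le (κ j) (θ i) (κ K)
  have hup := abs_sub_le (θ i) (κ K) (κ j)
  rw [abs_sub_comm (κ j) (θ i)] at hlow
  rw [abs_sub_comm (κ K) (κ j)] at hup
  constructor <;> linarith [(hκ j hj).1, (hκ j hj).2]

theorem isTheta_sub_of_isLadder {α : Type*} {l : Filter α} {κ : ℕ → ℝ} {K : ℕ} {c C : ℝ}
    {g θ θ' : α → ℝ} (hc : 0 < c)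
    (hκ : ∀ j, j ≠ K → c ≤ |κ j - κ K| ∧ |κ j - κ K| ≤ C) (hg : Filter.Tendsto g l (𝓝 0))
    (hθ : Filter.Tendsto θ l (𝓝 (κ K))) (hθ' : Filter.Tendsto θ' l (𝓝 (κ K)))
    (hz : ∀ᶠ i in l, ∃ z, IsLadder (fun j => θ i - κ j) (g i) (-g i) z ∧
      BddAbove (Set.range fun j => |z j|) ∧ z K ≠ 0)
    (hw : ∀ᶠ i in l, ∃ w, IsLadder (fun j => θ' i - κ j) (g i) (g i) w ∧
      BddAbove (Set.range fun j => |w j|) ∧ w K ≠ 0) :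
    (fun i => θ i - θ' i) =Θ[l] fun i => g i ^ (2 * K + 1) := by
  have hsmall : ∀ᶠ i in l, |g i| ≤ c / 2 / 4 := by
    filter_upwards [Metric.tendsto_nhds.1 hg (c / 2 / 4) (by positivity)] with i hi
    simpa [Real.dist_eq] using hi.le
  have hbounds := hsmall.and <| (eventually_bounds_abs_sub hc hκ hθ).and <|
    (eventually_bounds_abs_sub hc hκ hθ').and <| hz.and hw
  refine ⟨.of_bound (6 * (2 / (c / 2)) ^ (2 * K)) (hbounds.mono ?_),
    .of_bound ((2 * (C + c / 2)) ^ (2 * K)) (hbounds.mono ?_)⟩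
  · rintro i ⟨hgi, hi, hi', ⟨_, hzi, hzb, hzK⟩, _, hwi, hwb, hwK⟩
    rw [norm_pow]
    exact hzi.gap_le hwi hzb hwb hzK hwK (half_pos hc) hgi (fun j hj => (hi j hj).1)
      fun j hj => (hi' j hj).1
  · rintro i ⟨hgi, hi, hi', ⟨_, hzi, hzb, hzK⟩, _, hwi, hwb, hwK⟩
    rw [norm_pow]
    exact hzi.pow_le_gap hwi hzb hwb hzK hwK (half_pos hc) hgi hi hi'

end Ladder

section ImplicitCurve

lemma sign_eq_sign_of_abs_sub_le {u v : ℝ} (h : |u - v| ≤ |v| / 2) :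
    SignType.sign u = SignType.sign v := by
  have hle := abs_le.1 h
  rcases lt_trichotomy v 0 with hv | rfl | hv
  · rw [abs_of_neg hv] at hle
    rw [sign_neg hv, sign_neg (by linarith)]
  · rw [abs_zero, zero_div, sub_zero] at h
    rw [abs_nonpos_iff.1 h]
  · rw [abs_of_pos hv] at hle
    rw [sign_pos hv, sign_pos (by linarith)]

variable {f : ℝ × ℝ → ℝ} {x₀ y₀ m : ℝ}

lemma eventually_sign_eq_of_hasStrictFDerivAt {f' : ℝ × ℝ →L[ℝ] ℝ} {a : ℝ → ℝ}
    (hf : HasStrictFDerivAt f f' (x₀, a x₀)) (hf' : f' (0, 1) ≠ 0) (ha : ContinuousAt a x₀)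
    (hzero : ∀ᶠ x in 𝓝 x₀, f (x, a x) = 0) :
    ∀ᶠ p : ℝ × ℝ in 𝓝 (x₀, a x₀),
      SignType.sign (f p) = SignType.sign (f' (0, 1)) * SignType.sign (p.2 - a p.1) := by
  have hcurve : ContinuousAt (fun p : ℝ × ℝ => (p, (p.1, a p.1))) (x₀, a x₀) :=
    continuousAt_id.prodMk (continuousAt_fst.prodMk (ha.comp' continuousAt_fst))
  have hstrict := hf.isLittleO.def (c := |f' (0, 1)| / 2) (half_pos (abs_pos.2 hf'))
  filter_upwards [hcurve.eventually hstrict, (continuousAt_fst (p := (x₀, a x₀))).eventually hzero]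
    with p hp hp0
  have hvert : p - (p.1, a p.1) = (p.2 - a p.1) • ((0 : ℝ), (1 : ℝ)) := by ext <;> simp
  rw [← sign_mul]
  refine sign_eq_sign_of_abs_sub_le ?_
  rw [hp0, hvert, map_smul, sub_zero, norm_smul, smul_eq_mul, mul_comm (p.2 - a p.1)] at hp
  refine hp.trans_eq ?_
  simp only [Prod.norm_mk, norm_zero, norm_one, Real.norm_eq_abs, abs_mul]
  norm_num
  ring

theorem exists_analyticAt_implicit (hf : AnalyticAt ℝ f (x₀, y₀)) (h0 : f (x₀, y₀) = 0)
    (hm : HasDerivAt (fun y => f (x₀, y)) m y₀) (hm0 : m ≠ 0) :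
    ∃ a : ℝ → ℝ, AnalyticAt ℝ a x₀ ∧ a x₀ = y₀ ∧ (∀ᶠ x in 𝓝 x₀, f (x, a x) = 0) ∧
      ∀ᶠ p : ℝ × ℝ in 𝓝 (x₀, y₀),
        SignType.sign (f p) = SignType.sign m * SignType.sign (p.2 - a p.1) := by
  have hcd : ContDiffAt ℝ ⊤ f (x₀, y₀) := hf.contDiffAt
  have htop : (⊤ : WithTop ℕ∞) ≠ 0 := by simp
  have hvert : fderiv ℝ f (x₀, y₀) (0, 1) = m :=
    (hf.differentiableAt.hasFDerivAt.comp_hasDerivAt y₀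
      ((hasDerivAt_const y₀ x₀).prodMk (hasDerivAt_id y₀))).unique hm
  have hinv : (fderiv ℝ f (x₀, y₀) ∘L .inr ℝ ℝ ℝ).IsInvertible :=
    .of_inverse (g := m⁻¹ • .id ℝ ℝ) (by ext; simp [hvert, hm0]) (by ext; simp [hvert, hm0])
  have hzero := hcd.eventually_apply_implicitFunction htop hinv
  have hself := hcd.implicitFunction_apply_self htop hinv
  have han := (hcd.contDiffAt_implicitFunction htop hinv).analyticAt
  simp only [h0] at hzero hself han
  refine ⟨_, han, hself, hzero, ?_⟩
  have hsign := eventually_sign_eq_of_hasStrictFDerivAt (hself.symm ▸ hf.hasStrictFDerivAt)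
    (by rw [hself, hvert]; exact hm0) han.continuousAt hzero
  rwa [hself, hvert] at hsign

end ImplicitCurve

section Frontier

variable {X : Type*} [TopologicalSpace X]

lemma mem_frontier_iff_frequently {S : Set X} {p : X} :
    p ∈ frontier S ↔ (∃ᶠ q in 𝓝 p, q ∈ S) ∧ ∃ᶠ q in 𝓝 p, q ∉ S := by
  rw [frontier_eq_closure_inter_closure, Set.mem_inter_iff, mem_closure_iff_frequently,
    mem_closure_iff_frequently]
  rfl

/-- The part of the plane lying above or below both curves `y = a x` and `y = b x`, together with
the points at which they meet. -/
def wedgeExterior (a b : ℝ → ℝ) : Set (ℝ × ℝ) :=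
  {p | 0 < (p.2 - a p.1) * (p.2 - b p.1) ∨ p.2 = a p.1 ∧ p.2 = b p.1}

variable {a b : ℝ → ℝ} {x : ℝ} {p : ℝ × ℝ}

lemma wedgeExterior_comm (a b : ℝ → ℝ) : wedgeExterior a b = wedgeExterior b a := by
  ext p
  rw [wedgeExterior, wedgeExterior, Set.mem_ofPred_eq, Set.mem_ofPred_eq, mul_comm, and_comm]

lemma mem_uIcc_iff_sub_mul_sub_nonpos {a b y : ℝ} :
    y ∈ Set.uIcc a b ↔ (y - a) * (y - b) ≤ 0 := by
  rw [Set.mem_uIcc, mul_nonpos_iff, sub_nonneg, sub_nonneg, sub_nonpos, sub_nonpos]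
  tauto

lemma notMem_wedgeExterior_iff :
    p ∉ wedgeExterior a b ↔ a p.1 ≠ b p.1 ∧ p.2 ∈ Set.uIcc (a p.1) (b p.1) := by
  rw [mem_uIcc_iff_sub_mul_sub_nonpos, wedgeExterior, Set.mem_ofPred_eq, not_or, not_lt, and_comm]
  refine and_congr_left fun hle => not_congr ⟨fun h => h.1.symm.trans h.2, fun h => ?_⟩
  rw [← h] at hle ⊢
  have heq : p.2 = a p.1 := sub_eq_zero.1 (mul_self_eq_zero.1 (hle.antisymm (mul_self_nonneg _)))
  exact ⟨heq, heq⟩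

lemma notMem_frontier_wedgeExterior (ha : ContinuousAt a p.1) (hb : ContinuousAt b p.1)
    (hpa : p.2 ≠ a p.1) (hpb : p.2 ≠ b p.1) : p ∉ frontier (wedgeExterior a b) := by
  have hcont : ContinuousAt (fun q : ℝ × ℝ => (q.2 - a q.1) * (q.2 - b q.1)) p :=
    (continuousAt_snd.sub (ha.comp' continuousAt_fst)).mul
      (continuousAt_snd.sub (hb.comp' continuousAt_fst))
  rw [mem_frontier_iff_frequently, not_and_or, Filter.not_frequently, Filter.not_frequently]
  rcases (mul_ne_zero (sub_ne_zero.2 hpa) (sub_ne_zero.2 hpb)).lt_or_gt with hlt | hgt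
  · refine .inl ((hcont.eventually_lt_const hlt).mono ?_)
    rintro q hq (hq' | ⟨hqa, -⟩)
    · exact hq.not_gt hq'
    · simp [hqa] at hq
  · exact .inr ((hcont.eventually_const_lt hgt).mono fun q hq => not_not.2 (.inl hq))

lemma mem_frontier_wedgeExterior_of_ne (h : a x ≠ b x) :
    (x, a x) ∈ frontier (wedgeExterior a b) := by
  have hvert : Filter.Tendsto (fun s : ℝ => (x, a x + s * (a x - b x))) (𝓝[>] 0)
      (𝓝 (x, a x)) := by
    have hcont : Continuous fun s : ℝ => (x, a x + s * (a x - b x)) := by fun_prop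
    simpa using (hcont.tendsto 0).mono_left (nhdsWithin_le_nhds (s := Set.Ioi 0))
  rw [frontier_eq_closure_inter_closure]
  refine ⟨mem_closure_of_tendsto hvert ?_, subset_closure (by simp [wedgeExterior, h])⟩
  filter_upwards [self_mem_nhdsWithin] with s (hs : 0 < s)
  left
  calc 0 < s * (1 + s) * (a x - b x) ^ 2 :=
        mul_pos (by positivity) (sq_pos_of_ne_zero (sub_ne_zero.2 h))
    _ = (a x + s * (a x - b x) - a x) * (a x + s * (a x - b x) - b x) := by ring

lemma mem_frontier_wedgeExterior_of_eq (ha : ContinuousAt a x) (h : a x = b x)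
    (hne : ∀ᶠ t in 𝓝[≠] x, a t ≠ b t) : (x, a x) ∈ frontier (wedgeExterior a b) := by
  have hcurve : Filter.Tendsto (fun t => (t, a t)) (𝓝[≠] x) (𝓝 (x, a x)) :=
    (continuousAt_id.prodMk ha).tendsto.mono_left nhdsWithin_le_nhds
  rw [frontier_eq_closure_inter_closure]
  refine ⟨subset_closure (.inr ⟨rfl, h⟩), mem_closure_of_tendsto hcurve ?_⟩
  filter_upwards [hne] with t ht
  simp [wedgeExterior, ht]

lemma mem_frontier_wedgeExterior (ha : ContinuousAt a x) (hne : ∀ᶠ t in 𝓝[≠] x, a t ≠ b t) :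
    (x, a x) ∈ frontier (wedgeExterior a b) := by
  by_cases h : a x = b x
  · exact mem_frontier_wedgeExterior_of_eq ha h hne
  · exact mem_frontier_wedgeExterior_of_ne h

lemma mem_frontier_wedgeExterior_iff (ha : ContinuousAt a p.1) (hb : ContinuousAt b p.1)
    (hne : ∀ᶠ t in 𝓝[≠] p.1, a t ≠ b t) :
    p ∈ frontier (wedgeExterior a b) ↔ p.2 = a p.1 ∨ p.2 = b p.1 := by
  constructor
  · contrapose!
    exact fun h => notMem_frontier_wedgeExterior ha hb h.1 h.2
  · rcases p with ⟨x, y⟩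
    rintro (h | h)
    · obtain rfl : y = a x := h
      exact mem_frontier_wedgeExterior ha hne
    · obtain rfl : y = b x := h
      rw [wedgeExterior_comm]
      exact mem_frontier_wedgeExterior hb (hne.mono fun t ht => ht.symm)

theorem eventually_mem_frontier_iff {S : Set (ℝ × ℝ)} {x₀ y₀ : ℝ}
    (ha : ∀ᶠ x in 𝓝 x₀, ContinuousAt a x) (hb : ∀ᶠ x in 𝓝 x₀, ContinuousAt b x)
    (hne : ∀ᶠ x in 𝓝[≠] x₀, a x ≠ b x)
    (hS : ∀ᶠ p : ℝ × ℝ in 𝓝 (x₀, y₀), p ∈ S ↔ p ∈ wedgeExterior a b) :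
    ∀ᶠ p : ℝ × ℝ in 𝓝 (x₀, y₀), p ∈ frontier S ↔ p.2 = a p.1 ∨ p.2 = b p.1 := by
  have hne' : ∀ᶠ x in 𝓝 x₀, ∀ᶠ t in 𝓝[≠] x, a t ≠ b t := by
    filter_upwards [eventually_nhdsWithin_iff.1 (eventually_nhdsNE_eventually_nhds_iff.2 hne)]
      with x hx
    rcases eq_or_ne x x₀ with rfl | hx0
    · exact hne
    · exact nhdsWithin_le_nhds (hx hx0)
  have hfst : Filter.Tendsto Prod.fst (𝓝 (x₀, y₀)) (𝓝 x₀) := continuousAt_fst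
  filter_upwards [hfst.eventually ha, hfst.eventually hb, hfst.eventually hne',
    eventually_eventually_nhds.2 hS] with p hpa hpb hpne hpS
  rw [← mem_frontier_wedgeExterior_iff hpa hpb hpne, mem_frontier_iff_frequently,
    mem_frontier_iff_frequently, Filter.frequently_congr hpS,
    Filter.frequently_congr (hpS.mono fun q hq => not_congr hq)]

end Frontier

section Contact

lemma isTheta_one_of_tendsto {α E : Type*} [NormedAddCommGroup E] {l : Filter α} {u : α → E}
    {c : E} (hu : Filter.Tendsto u l (𝓝 c)) (hc : c ≠ 0) : u =Θ[l] fun _ => (1 : ℝ) :=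
  ((Asymptotics.isEquivalent_const_iff_tendsto hc).2 hu).isTheta.trans
    (Asymptotics.isTheta_const_const hc one_ne_zero)

variable {E : Type*} [NormedAddCommGroup E] [NormedSpace ℝ E] {f g : ℝ → E} {x₀ : ℝ} {n : ℕ}

lemma isTheta_pow_of_analyticOrderAt_eq (hf : AnalyticAt ℝ f x₀)
    (h : analyticOrderAt f x₀ = n) : f =Θ[𝓝 x₀] fun x => (x - x₀) ^ n := by
  obtain ⟨u, hu, hu0, hfu⟩ := hf.analyticOrderAt_eq_natCast.1 h
  have hunit := isTheta_one_of_tendsto hu.continuousAt hu0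
  have hprod := (Asymptotics.isTheta_refl (fun x : ℝ => (x - x₀) ^ n) (𝓝 x₀)).smul hunit
  simp only [smul_eq_mul, mul_one] at hprod
  exact (Filter.EventuallyEq.isTheta hfu).trans hprod

lemma analyticOrderAt_eq_of_isTheta (hf : AnalyticAt ℝ f x₀)
    (h : f =Θ[𝓝 x₀] fun x => (x - x₀) ^ n) : analyticOrderAt f x₀ = n := by
  have hne (j : ℕ) : ∃ᶠ x in 𝓝 x₀, (x - x₀) ^ j ≠ 0 := by
    have hpunctured : ∀ᶠ x in 𝓝[≠] x₀, (x - x₀) ^ j ≠ 0 := by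
      filter_upwards [self_mem_nhdsWithin] with x hx using pow_ne_zero j (sub_ne_zero.2 hx)
    exact hpunctured.frequently.filter_mono nhdsWithin_le_nhds
  have hlittle {i j : ℕ} (hij : i < j) :
      (fun x => (x - x₀) ^ j) =o[𝓝 x₀] fun x => (x - x₀) ^ i :=
    (Asymptotics.isLittleO_pow_pow hij).comp_tendsto (tendsto_sub_nhds_zero_iff.2 Filter.tendsto_id)
  cases hN : analyticOrderAt f x₀ with
  | top =>
    have hzero := Asymptotics.isBigO_zero_right_iff.1
      (h.2.trans_eventuallyEq (analyticOrderAt_eq_top.1 hN))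
    exact absurd hzero fun hzero => hne n (hzero.mono fun x hx => not_not.2 hx)
  | coe N =>
    have hpow := (isTheta_pow_of_analyticOrderAt_eq hf hN).symm.trans h
    rcases lt_trichotomy N n with hlt | rfl | hlt
    · exact absurd (hlittle hlt) (hpow.1.not_isLittleO (hne N))
    · rfl
    · exact absurd (hlittle hlt) (hpow.2.not_isLittleO (hne n))

lemma iteratedDeriv_eq_and_ne_of_isTheta [CompleteSpace E] (hf : AnalyticAt ℝ f x₀)
    (hg : AnalyticAt ℝ g x₀) (h : (fun x => f x - g x) =Θ[𝓝 x₀] fun x => (x - x₀) ^ n) :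
    (∀ j < n, iteratedDeriv j f x₀ = iteratedDeriv j g x₀) ∧
      iteratedDeriv n f x₀ ≠ iteratedDeriv n g x₀ := by
  have horder := (analyticOrderAt_eq_nat_iff_iteratedDeriv_eq_zero (hf.sub hg)).1
    (analyticOrderAt_eq_of_isTheta (hf.sub hg) h)
  have hderiv (j : ℕ) :
      iteratedDeriv j (f - g) x₀ = iteratedDeriv j f x₀ - iteratedDeriv j g x₀ :=
    iteratedDeriv_sub hf.contDiffAt hg.contDiffAt
  simp only [hderiv, sub_eq_zero] at horder
  exact ⟨horder.1, sub_ne_zero.1 horder.2⟩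

end Contact

section Ince

/-- The leading coefficient `1 + ε cos 2t` of the Ince equation. -/
noncomputable def inceCoeff (ε t : ℝ) : ℝ := 1 + ε * Real.cos (2 * t)

/-- The Ince equation `((1 + ε cos 2t) x')' + l x = 0` as a first order system. The equation of
`IsInceSolution ω γ δ` is the case `ε = δ γ`, `l = 4 (δ / ω²)`. -/
abbrev IsInceSystem (ε l : ℝ) : (ℝ → ℝ) → (ℝ → ℝ) → Prop :=
  IsSturmLiouvilleSystem (inceCoeff ε) fun _ => l

variable {ε l ω γ δ : ℝ} {x y : ℝ → ℝ}

lemma abs_mul_cos_le (ε t : ℝ) : |ε * Real.cos t| ≤ |ε| := by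
  rw [abs_mul]
  exact mul_le_of_le_one_right (abs_nonneg _) (Real.abs_cos_le_one _)

lemma one_sub_abs_le_inceCoeff (ε t : ℝ) : 1 - |ε| ≤ inceCoeff ε t := by
  linarith [neg_le_of_abs_le (abs_mul_cos_le ε (2 * t)), inceCoeff.eq_1 ε t]

lemma inceCoeff_le_one_add_abs (ε t : ℝ) : inceCoeff ε t ≤ 1 + |ε| :=
  add_le_add_right (le_of_abs_le (abs_mul_cos_le ε (2 * t))) 1

lemma inceCoeff_pos (hε : |ε| < 1) (t : ℝ) : 0 < inceCoeff ε t :=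
  (sub_pos.2 hε).trans_le (one_sub_abs_le_inceCoeff ε t)

lemma hasDerivAt_inceCoeff (ε t : ℝ) :
    HasDerivAt (inceCoeff ε) (-2 * ε * Real.sin (2 * t)) t :=
  (((((hasDerivAt_id t).const_mul 2).cos).const_mul ε).const_add 1).congr_deriv
    (by simp only [id_eq]; ring)

lemma even_inceCoeff (ε : ℝ) : Function.Even (inceCoeff ε) := fun t => by
  simp only [inceCoeff, mul_neg, Real.cos_neg]

lemma periodic_inceCoeff (ε : ℝ) : Function.Periodic (inceCoeff ε) π := fun t => by
  simp only [inceCoeff, mul_add, Real.cos_add_two_pi]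

lemma inceCoeff_pi_div_two_sub (ε t : ℝ) : inceCoeff ε (π / 2 - t) = inceCoeff (-ε) t := by
  simp only [inceCoeff, mul_sub, mul_div_cancel₀ π two_ne_zero, Real.cos_pi_sub, neg_mul, mul_neg]

lemma isInceSolution_iff (hε : |δ * γ| < 1) :
    IsInceSolution ω γ δ x ↔ ∃ y, IsInceSystem (δ * γ) (4 * (δ / ω ^ 2)) x y := by
  constructor
  · rintro ⟨hx, hx', hode⟩
    refine ⟨fun t => inceCoeff (δ * γ) t * deriv x t, fun t => ?_, fun t => ?_⟩
    · rw [mul_div_cancel_left₀ _ (inceCoeff_pos hε t).ne']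
      exact (hx t).hasDerivAt
    · have ht := hode t
      rw [← inceCoeff] at ht
      exact ((hasDerivAt_inceCoeff (δ * γ) t).fun_mul (hx' t).hasDerivAt).congr_deriv
        (by linarith)
  · rintro ⟨y, h⟩
    have hderiv : ∀ t, HasDerivAt (deriv x) _ t := fun t => by
      rw [h.deriv_left]
      exact (h.right t).fun_div (hasDerivAt_inceCoeff _ t) (inceCoeff_pos hε t).ne'
    refine ⟨fun t => (h.left t).differentiableAt, fun t => (hderiv t).differentiableAt,
      fun t => ?_⟩
    have hpos := (inceCoeff_pos hε t).ne'
    rw [(hderiv t).deriv, h.deriv_left, ← inceCoeff]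
    field_simp
    ring

lemma IsInceSystem.right_eq (hε : |ε| < 1) (h : IsInceSystem ε l x y) (t : ℝ) :
    y t = inceCoeff ε t * deriv x t := by
  rw [h.deriv_left, mul_div_cancel₀ _ (inceCoeff_pos hε t).ne']

lemma IsInceSystem.mul_abs_deriv_le (hε : |ε| < 1) (h : IsInceSystem ε l x y) (t : ℝ) :
    (1 - |ε|) * |deriv x t| ≤ |y t| := by
  rw [h.right_eq hε, abs_mul, abs_of_pos (inceCoeff_pos hε t)]
  exact mul_le_mul_of_nonneg_right (one_sub_abs_le_inceCoeff ε t) (abs_nonneg _)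

lemma IsInceSystem.abs_le_two_mul_abs_deriv (hε : |ε| < 1) (h : IsInceSystem ε l x y) (t : ℝ) :
    |y t| ≤ 2 * |deriv x t| := by
  rw [h.right_eq hε, abs_mul, abs_of_pos (inceCoeff_pos hε t)]
  exact mul_le_mul_of_nonneg_right (by linarith [inceCoeff_le_one_add_abs ε t]) (abs_nonneg _)

lemma originStable_of_exists_sq_add_sq_le (hε : |δ * γ| < 1)
    (hS : ∃ S, ∀ x y, IsInceSystem (δ * γ) (4 * (δ / ω ^ 2)) x y → ∀ t, 0 ≤ t →
      x t ^ 2 + y t ^ 2 ≤ S * (x 0 ^ 2 + y 0 ^ 2)) :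
    OriginStable ω γ δ := by
  obtain ⟨S, hS⟩ := hS
  intro e he
  have hc : 0 < 1 - |δ * γ| := sub_pos.2 hε
  set c := 1 - |δ * γ|
  set η := c * e / (3 * (|S| + 1)) with hη
  refine ⟨η, by positivity, fun x hx hx0 hx0' t ht => ?_⟩
  obtain ⟨y, hy⟩ := (isInceSolution_iff hε).1 hx
  have hinit : x 0 ^ 2 + y 0 ^ 2 ≤ 5 * η ^ 2 := by
    have hxsq := sq_le_sq' (abs_lt.1 hx0).1.le (abs_lt.1 hx0).2.le
    have hysq : y 0 ^ 2 ≤ (2 * η) ^ 2 := by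
      rw [← sq_abs (y 0)]
      gcongr
      linarith [hy.abs_le_two_mul_abs_deriv hε 0]
    linarith
  have hbound : x t ^ 2 + y t ^ 2 < (c * e) ^ 2 :=
    calc x t ^ 2 + y t ^ 2 ≤ S * (x 0 ^ 2 + y 0 ^ 2) := hS x y hy t ht
      _ ≤ (|S| + 1) * (5 * η ^ 2) := by
        refine mul_le_mul (by linarith [le_abs_self S]) hinit (by positivity) (by positivity)
      _ = 5 / 9 / (|S| + 1) * (c * e) ^ 2 := by
        rw [hη]
        field_simp
        norm_num
      _ < 1 * (c * e) ^ 2 := by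
        gcongr
        rw [div_lt_one (by positivity)]
        linarith [abs_nonneg S]
      _ = (c * e) ^ 2 := one_mul _
  have hxt : |x t| < c * e := abs_lt_of_sq_lt_sq (by linarith [sq_nonneg (y t)]) (by positivity)
  have hyt : |y t| < c * e := abs_lt_of_sq_lt_sq (by linarith [sq_nonneg (x t)]) (by positivity)
  have hc1 : c ≤ 1 := sub_le_self 1 (abs_nonneg _)
  exact ⟨hxt.trans_le (mul_le_of_le_one_left he.le hc1),
    lt_of_mul_lt_mul_left ((hy.mul_abs_deriv_le hε t).trans_lt hyt) hc.le⟩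

lemma not_originStable_of_unbounded (hε : |δ * γ| < 1)
    (h : IsInceSystem (δ * γ) (4 * (δ / ω ^ 2)) x y)
    (hunb : ∀ R, ∃ t, 0 ≤ t ∧ (R < |x t| ∨ R < |y t|)) : ¬ OriginStable ω γ δ := by
  intro hstable
  obtain ⟨η, hη, hsmall⟩ := hstable 1 one_pos
  have hden : 0 < 1 + |x 0| + |deriv x 0| := by positivity
  set c := η / (1 + |x 0| + |deriv x 0|) with hc
  have hc0 : 0 < c := by positivity
  have hscale {r : ℝ} (hr : |r| < 1 + |x 0| + |deriv x 0|) : |c * r| < η := by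
    rw [abs_mul, abs_of_pos hc0, hc, div_mul_eq_mul_div, div_lt_iff₀ hden]
    exact mul_lt_mul_of_pos_left hr hη
  have hderiv (t : ℝ) : deriv (fun t => c * x t) t = c * deriv x t :=
    deriv_const_mul c (h.left t).differentiableAt
  have hbound (t : ℝ) (ht : 0 ≤ t) : |c * x t| < 1 ∧ |c * deriv x t| < 1 := by
    rw [← hderiv]
    refine hsmall _ ((isInceSolution_iff hε).2 ⟨_, h.const_mul c⟩)
      (hscale (by linarith [abs_nonneg (deriv x 0)])) ?_ t ht
    rw [hderiv]
    exact hscale (by linarith [abs_nonneg (x 0)])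
  obtain ⟨t, ht, hlarge⟩ := hunb (2 / c)
  obtain ⟨hxt, hxt'⟩ := hbound t ht
  rw [abs_mul, abs_of_pos hc0] at hxt hxt'
  rw [div_lt_iff₀' hc0, div_lt_iff₀' hc0] at hlarge
  have hyt := mul_le_mul_of_nonneg_left (h.abs_le_two_mul_abs_deriv hε t) hc0.le
  rcases hlarge with hlarge | hlarge <;> linarith

section Criteria

variable {x₁ y₁ x₂ y₂ : ℝ → ℝ}

lemma originStable_iff (hε : |δ * γ| < 1)
    (h : IsFundamentalPair (inceCoeff (δ * γ)) (fun _ => 4 * (δ / ω ^ 2)) x₁ y₁ x₂ y₂)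
    (hlt : x₁ (π / 2) * y₂ (π / 2) < 1) :
    OriginStable ω γ δ ↔
      0 < x₁ (π / 2) * y₂ (π / 2) ∨ x₁ (π / 2) = 0 ∧ y₂ (π / 2) = 0 := by
  have hq : Function.Periodic (fun _ : ℝ => 4 * (δ / ω ^ 2)) π := fun _ => rfl
  have hq' : Function.Even fun _ : ℝ => 4 * (δ / ω ^ 2) := fun _ => rfl
  have hp := periodic_inceCoeff (δ * γ)
  have hp' := even_inceCoeff (δ * γ)
  constructor
  · contrapose!
    rintro ⟨hle, hne⟩
    obtain ⟨u, v, huv, hunb⟩ := h.exists_unbounded hp hq hp' hq' hle fun h0 => hne h0.1 h0.2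
    refine not_originStable_of_unbounded hε huv fun R => ?_
    obtain ⟨n, hn⟩ := hunb R
    exact ⟨n * π, by positivity, hn⟩
  · rintro (hpos | ⟨hx, hy⟩)
    · exact originStable_of_exists_sq_add_sq_le hε
        (h.exists_sq_add_sq_le_of_pos hp hq hp' hq' Real.pi_pos hpos hlt)
    · exact originStable_of_exists_sq_add_sq_le hε
        (h.exists_sq_add_sq_le_of_eq_zero hp hq hp' hq' Real.pi_pos hx hy)

lemma hasEvenPeriodicSolution_iff (hε : |δ * γ| < 1)
    (h : IsFundamentalPair (inceCoeff (δ * γ)) (fun _ => 4 * (δ / ω ^ 2)) x₁ y₁ x₂ y₂)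
    (hlt : x₁ (π / 2) * y₂ (π / 2) < 1) :
    HasEvenPeriodicSolution ω γ δ ↔ x₁ (π / 2) = 0 := by
  have hy₁ : y₁ (π / 2) ≠ 0 := fun h0 => by
    linarith [h.wronskian (π / 2), mul_eq_zero_of_right (x₂ (π / 2)) h0]
  rw [← h.exists_even_periodic_iff (periodic_inceCoeff _) (fun _ => rfl) (even_inceCoeff _)
    (fun _ => rfl) (inceCoeff_pos hε 0).ne' hy₁]
  simp only [HasEvenPeriodicSolution, isInceSolution_iff hε, exists_and_right]

lemma hasOddPeriodicSolution_iff (hε : |δ * γ| < 1)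
    (h : IsFundamentalPair (inceCoeff (δ * γ)) (fun _ => 4 * (δ / ω ^ 2)) x₁ y₁ x₂ y₂)
    (hlt : x₁ (π / 2) * y₂ (π / 2) < 1) :
    HasOddPeriodicSolution ω γ δ ↔ y₂ (π / 2) = 0 := by
  have hx₂ : x₂ (π / 2) ≠ 0 := fun h0 => by
    linarith [h.wronskian (π / 2), mul_eq_zero_of_left h0 (y₁ (π / 2))]
  rw [← h.exists_odd_periodic_iff (periodic_inceCoeff _) (fun _ => rfl) (even_inceCoeff _)
    (fun _ => rfl) (inceCoeff_pos hε 0).ne' hx₂]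
  simp only [HasOddPeriodicSolution, isInceSolution_iff hε, exists_and_right]

end Criteria

end Ince

section InceFlow

/-- `t ↦ cos (n t)` as a bounded continuous function. -/
noncomputable def boundedCos (n : ℝ) : ℝ →ᵇ ℝ :=
  BoundedContinuousFunction.ofNormedAddCommGroup (fun t => Real.cos (n * t)) (by fun_prop) 1
    fun t => Real.abs_cos_le_one _

/-- The reciprocal `1 / (1 + ε cos 2t)` of the leading coefficient, as an element of the Banach
algebra of bounded continuous functions; meaningful for `|ε| < 1`. -/
noncomputable def invInceCoeff (ε : ℝ) : ℝ →ᵇ ℝ := Ring.inverse (1 + ε • boundedCos 2)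

/-- The coefficient matrix `(x, y) ↦ (y / (1 + ε cos 2t), -l x)` of `IsInceSystem ε l`, as a
bounded function of `t`. -/
noncomputable def inceGenerator (ε l : ℝ) : ℝ →ᵇ ((ℝ × ℝ) →L[ℝ] (ℝ × ℝ)) :=
  (ContinuousLinearMap.toSpanSingleton ℝ
      ((ContinuousLinearMap.inl ℝ ℝ ℝ).comp (ContinuousLinearMap.snd ℝ ℝ ℝ)
        )).compLeftContinuousBounded ℝ (invInceCoeff ε) -
    l • BoundedContinuousFunction.const ℝ
      ((ContinuousLinearMap.inr ℝ ℝ ℝ).comp (ContinuousLinearMap.fst ℝ ℝ ℝ))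

/-- The fundamental matrix of the Ince equation, acting on initial values `(x 0, y 0)`. -/
noncomputable def inceFlow (ε l : ℝ) : ℝ → (ℝ × ℝ) →L[ℝ] (ℝ × ℝ) :=
  fundamentalSolution (inceGenerator ε l)

variable {ε : ℝ}

lemma isUnit_one_add_smul_boundedCos (hε : |ε| < 1) (n : ℝ) : IsUnit (1 + ε • boundedCos n) := by
  have hcos : ‖boundedCos n‖ ≤ 1 :=
    BoundedContinuousFunction.norm_ofNormedAddCommGroup_le _ zero_le_one _
  rw [← sub_neg_eq_add]
  refine isUnit_one_sub_of_norm_lt_one ?_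
  rw [norm_neg, norm_smul]
  exact (mul_le_of_le_one_right (norm_nonneg _) hcos).trans_lt hε

lemma invInceCoeff_apply (hε : |ε| < 1) (t : ℝ) : invInceCoeff ε t = (inceCoeff ε t)⁻¹ :=
  eq_inv_of_mul_eq_one_left
    (DFunLike.congr_fun (Ring.inverse_mul_cancel _ (isUnit_one_add_smul_boundedCos hε 2)) t)

lemma analyticAt_invInceCoeff (hε : |ε| < 1) : AnalyticAt ℝ invInceCoeff ε := by
  obtain ⟨u, hu⟩ := isUnit_one_add_smul_boundedCos hε 2
  have hinv : AnalyticAt ℝ (Ring.inverse : (ℝ →ᵇ ℝ) → (ℝ →ᵇ ℝ)) (1 + ε • boundedCos 2) := by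
    rw [← hu]
    exact analyticAt_inverse u
  exact hinv.comp (f := fun ε : ℝ => 1 + ε • boundedCos 2) (by fun_prop)

lemma analyticAt_inceGenerator (hε : |ε| < 1) (l : ℝ) :
    AnalyticAt ℝ (fun p : ℝ × ℝ => inceGenerator p.1 p.2) (ε, l) := by
  have hinv : AnalyticAt ℝ (fun p : ℝ × ℝ => invInceCoeff p.1) (ε, l) :=
    AnalyticAt.comp (g := invInceCoeff) (f := Prod.fst) (analyticAt_invInceCoeff hε)
      analyticAt_fst
  exact ((ContinuousLinearMap.analyticAt _ _).comp hinv).sub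
    (((ContinuousLinearMap.toSpanSingleton ℝ _).analyticAt _).comp analyticAt_snd)

lemma analyticAt_inceFlow (hε : |ε| < 1) (l t : ℝ) :
    AnalyticAt ℝ (fun p : ℝ × ℝ => inceFlow p.1 p.2 t) (ε, l) :=
  (analyticAt_fundamentalSolution t _).comp (analyticAt_inceGenerator hε l)

lemma isInceSystem_inceFlow (hε : |ε| < 1) (l : ℝ) (v : ℝ × ℝ) :
    IsInceSystem ε l (fun t => (inceFlow ε l t v).1) fun t => (inceFlow ε l t v).2 := by
  have hflow (t : ℝ) : HasDerivAt (fun t => inceFlow ε l t v)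
      ((inceFlow ε l t v).2 / inceCoeff ε t, -(l * (inceFlow ε l t v).1)) t := by
    refine ((hasDerivAt_fundamentalSolution (inceGenerator ε l) t).clm_apply
      (hasDerivAt_const t v)).congr_deriv ?_
    simp [inceGenerator, inceFlow, invInceCoeff_apply hε, inv_mul_eq_div]
  exact ⟨fun t => (hflow t).fst, fun t => (hflow t).snd⟩

/-- The solution of the Ince equation with initial values `x 0 = 1`, `x' 0 = 0`. -/
noncomputable def inceEven (ε l t : ℝ) : ℝ := (inceFlow ε l t (1, 0)).1

/-- The upper left entry of an endomorphism of the plane, as a functional; `inceEven` is this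
entry of `inceFlow`. -/
noncomputable def upperLeftEntry : ((ℝ × ℝ) →L[ℝ] (ℝ × ℝ)) →L[ℝ] ℝ :=
  (ContinuousLinearMap.fst ℝ ℝ ℝ).comp (ContinuousLinearMap.apply ℝ (ℝ × ℝ) ((1, 0) : ℝ × ℝ))

lemma analyticAt_inceEven (hε : |ε| < 1) (l t : ℝ) :
    AnalyticAt ℝ (fun p : ℝ × ℝ => inceEven p.1 p.2 t) (ε, l) :=
  (upperLeftEntry.analyticAt _).comp (analyticAt_inceFlow hε l t)

lemma continuousAt_integral_inceEven_mul_cos (hε : |ε| < 1) (l n t : ℝ) :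
    ContinuousAt (fun p : ℝ × ℝ => ∫ s in (0 : ℝ)..t, inceEven p.1 p.2 s * Real.cos (n * s))
      (ε, l) :=
  (continuous_integral_fundamentalSolution upperLeftEntry (boundedCos n) t).continuousAt.comp
    (analyticAt_inceGenerator hε l).continuousAt

lemma isFundamentalPair_inceFlow (hε : |ε| < 1) (l : ℝ) :
    IsFundamentalPair (inceCoeff ε) (fun _ => l) (inceEven ε l)
      (fun t => (inceFlow ε l t (1, 0)).2) (fun t => (inceFlow ε l t (0, 1)).1)
      fun t => (inceFlow ε l t (0, 1)).2 where
  fst := isInceSystem_inceFlow hε l (1, 0)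
  snd := isInceSystem_inceFlow hε l (0, 1)
  x₁_zero := by simp [inceEven, inceFlow, fundamentalSolution_zero]
  y₁_zero := by simp [inceFlow, fundamentalSolution_zero]
  x₂_zero := by simp [inceFlow, fundamentalSolution_zero]
  y₂_zero := by simp [inceFlow, fundamentalSolution_zero]

/-- Shifting time by half a period changes the sign of `ε`, and reflecting it exchanges the two
normalised solutions. -/
lemma inceFlow_snd_pi_div_two (hε : |ε| < 1) (l : ℝ) :
    (inceFlow ε l (π / 2) (0, 1)).2 = inceEven (-ε) l (π / 2) := by
  have hpair := isFundamentalPair_inceFlow hε l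
  have hpair' := isFundamentalPair_inceFlow (abs_neg ε ▸ hε) l
  have hrefl := hpair'.fst.comp_const_sub (p' := inceCoeff ε) (q' := fun _ => l) (c := π / 2)
    (fun t => by rw [inceCoeff_pi_div_two_sub, neg_neg]) fun _ => rfl
  have hleft := hpair.left_eq hrefl (π / 2)
  have hright := hpair.right_eq hrefl (π / 2)
  have hwronskian := hpair.wronskian (π / 2)
  simp only [sub_self, sub_zero, hpair'.x₁_zero, hpair'.y₁_zero] at hleft hright
  linear_combination (inceFlow ε l (π / 2) (0, 1)).2 * hleft -
    (inceFlow ε l (π / 2) (0, 1)).1 * hright + inceEven (-ε) l (π / 2) * hwronskian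

lemma inceEven_zero_sq (κ t : ℝ) : inceEven 0 (κ ^ 2) t = Real.cos (κ * t) := by
  have hcos : IsInceSystem 0 (κ ^ 2) (fun t => Real.cos (κ * t))
      fun t => -(κ * Real.sin (κ * t)) := by
    refine ⟨fun t => ?_, fun t => ?_⟩
    · simpa [inceCoeff, mul_comm] using ((hasDerivAt_id t).const_mul κ).cos
    · exact ((((hasDerivAt_id t).const_mul κ).sin.const_mul κ).fun_neg).congr_deriv
        (by simp only [id_eq]; ring)
  simpa using ((isFundamentalPair_inceFlow (by simp) (κ ^ 2)).left_eq hcos t).symm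

end InceFlow

section Fourier

/-- Minus the `n`-th sine coefficient `∫ x' sin nt` over a quarter of the period `2π`, written so
as not to involve `x'`; the two agree when `x (π / 2) = 0`. -/
noncomputable def derivSinCoeff (x : ℝ → ℝ) (n : ℝ) : ℝ :=
  n * ∫ t in (0 : ℝ)..π / 2, x t * Real.cos (n * t)

lemma derivSinCoeff_neg (x : ℝ → ℝ) (n : ℝ) : derivSinCoeff x (-n) = -derivSinCoeff x n := by
  simp only [derivSinCoeff, neg_mul, Real.cos_neg]

lemma hasDerivAt_cos_mul (n t : ℝ) :
    HasDerivAt (fun t => Real.cos (n * t)) (-(n * Real.sin (n * t))) t :=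
  ((hasDerivAt_id t).const_mul n).cos.congr_deriv (by simp only [id_eq]; ring)

lemma hasDerivAt_sin_mul (n t : ℝ) :
    HasDerivAt (fun t => Real.sin (n * t)) (n * Real.cos (n * t)) t :=
  ((hasDerivAt_id t).const_mul n).sin.congr_deriv (by simp only [id_eq]; ring)

lemma integral_deriv_mul_sin_eq_neg_derivSinCoeff {x x' : ℝ → ℝ}
    (hx : ∀ t, HasDerivAt x (x' t) t) (hx' : Continuous x') (h0 : x (π / 2) = 0) (n : ℝ) :
    ∫ t in (0 : ℝ)..π / 2, x' t * Real.sin (n * t) = -derivSinCoeff x n := by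
  have hparts := intervalIntegral.integral_mul_deriv_eq_deriv_mul (a := 0) (b := π / 2)
    (fun t _ => hx t) (fun t _ => hasDerivAt_sin_mul n t) (hx'.intervalIntegrable _ _)
    (Continuous.intervalIntegrable (by fun_prop) _ _)
  simp only [h0, mul_zero, Real.sin_zero, zero_mul, mul_left_comm (x _),
    intervalIntegral.integral_const_mul] at hparts
  rw [derivSinCoeff]
  linarith

lemma abs_derivSinCoeff_le {x x' : ℝ → ℝ} {B : ℝ} (hx : ∀ t, HasDerivAt x (x' t) t)
    (hx' : Continuous x') (h0 : x (π / 2) = 0) (hB : ∀ t ∈ Set.Icc 0 (π / 2), |x' t| ≤ B)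
    (n : ℝ) : |derivSinCoeff x n| ≤ B * (π / 2) := by
  have hπ : (0 : ℝ) ≤ π / 2 := by positivity
  rw [← abs_neg, ← integral_deriv_mul_sin_eq_neg_derivSinCoeff hx hx' h0,
    ← Real.norm_eq_abs]
  calc ‖∫ t in (0 : ℝ)..π / 2, x' t * Real.sin (n * t)‖ ≤ B * |π / 2 - 0| := by
        refine intervalIntegral.norm_integral_le_of_norm_le_const fun t ht => ?_
        rw [Set.uIoc_of_le hπ] at ht
        rw [norm_mul]
        exact (mul_le_of_le_one_right (norm_nonneg _) (Real.abs_sin_le_one _)).trans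
          (hB t (Set.Ioc_subset_Icc_self ht))
    _ = B * (π / 2) := by rw [sub_zero, abs_of_nonneg hπ]

lemma cos_odd_mul_pi_div_two (j : ℕ) : Real.cos ((2 * (j : ℝ) + 1) * (π / 2)) = 0 :=
  Real.cos_eq_zero_iff.2 ⟨j, by push_cast; ring⟩

lemma integral_cos_sq_odd (K : ℕ) :
    ∫ t in (0 : ℝ)..π / 2, Real.cos ((2 * (K : ℝ) + 1) * t) ^ 2 = π / 4 := by
  rw [intervalIntegral.integral_comp_mul_left (fun t => Real.cos t ^ 2) (by positivity),
    integral_cos_sq, cos_odd_mul_pi_div_two]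
  simp only [mul_zero, Real.sin_zero, zero_mul, smul_eq_mul, sub_zero]
  field_simp
  ring

/-- The value `((2j+1) ω / 2)²` of `δ` from which the `j`-th tongue emanates, counting from
`j = 0`. -/
noncomputable def resonance (ω : ℝ) (j : ℕ) : ℝ := ((2 * (j : ℝ) + 1) * ω / 2) ^ 2

lemma resonance_pos {ω : ℝ} (hω : 0 < ω) (j : ℕ) : 0 < resonance ω j := by
  unfold resonance
  positivity

lemma strictAnti_inv_resonance {ω : ℝ} (hω : 0 < ω) : StrictAnti fun j => (resonance ω j)⁻¹ := by
  intro i j hij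
  refine inv_strictAnti₀ (resonance_pos hω i) ?_
  unfold resonance
  gcongr

namespace IsInceSystem

variable {ε l ω γ δ : ℝ} {x y : ℝ → ℝ}

lemma continuous_deriv (h : IsInceSystem ε l x y) (hε : |ε| < 1) :
    Continuous fun t => y t / inceCoeff ε t :=
  h.continuous_right.div
    (continuous_iff_continuousAt.2 fun t => (hasDerivAt_inceCoeff ε t).continuousAt)
    fun t => (inceCoeff_pos hε t).ne'

lemma mul_integral_right_mul_sin (h : IsInceSystem ε l x y) (hy : y 0 = 0) {n : ℝ}
    (hn : Real.cos (n * (π / 2)) = 0) :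
    n * (n * ∫ t in (0 : ℝ)..π / 2, y t * Real.sin (n * t)) = -l * derivSinCoeff x n := by
  have hxc := h.continuous_left
  have hparts := intervalIntegral.integral_mul_deriv_eq_deriv_mul (a := 0) (b := π / 2)
    (fun t _ => h.right t) (fun t _ => hasDerivAt_cos_mul n t)
    (Continuous.intervalIntegrable (by fun_prop) _ _)
    (Continuous.intervalIntegrable (by fun_prop) _ _)
  simp only [hn, hy, mul_zero, zero_mul, mul_neg, neg_mul, mul_left_comm (y _), mul_assoc,
    intervalIntegral.integral_const_mul, intervalIntegral.integral_neg] at hparts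
  rw [derivSinCoeff]
  linear_combination (-n) * hparts

lemma integral_right_mul_sin (h : IsInceSystem ε l x y) (hε : |ε| < 1) (hx : x (π / 2) = 0)
    (n : ℝ) :
    ∫ t in (0 : ℝ)..π / 2, y t * Real.sin (n * t) = -(derivSinCoeff x n +
      ε / 2 * (derivSinCoeff x (n + 2) + derivSinCoeff x (n - 2))) := by
  have hc := h.continuous_deriv hε
  have hproduct (t : ℝ) : y t * Real.sin (n * t) = y t / inceCoeff ε t * Real.sin (n * t) +
      ε / 2 * (y t / inceCoeff ε t * Real.sin ((n + 2) * t) +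
        y t / inceCoeff ε t * Real.sin ((n - 2) * t)) := by
    have hsum : Real.sin ((n + 2) * t) + Real.sin ((n - 2) * t) =
        2 * Real.sin (n * t) * Real.cos (2 * t) := by
      rw [add_mul, sub_mul, Real.sin_add, Real.sin_sub]
      ring
    rw [← mul_add, hsum]
    nth_rewrite 1 [← div_mul_cancel₀ (y t) (inceCoeff_pos hε t).ne']
    nth_rewrite 2 [inceCoeff]
    ring
  rw [intervalIntegral.integral_congr fun t _ => hproduct t,
    intervalIntegral.integral_add (Continuous.intervalIntegrable (by fun_prop) _ _)
      (Continuous.intervalIntegrable (by fun_prop) _ _),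
    intervalIntegral.integral_const_mul,
    intervalIntegral.integral_add (Continuous.intervalIntegrable (by fun_prop) _ _)
      (Continuous.intervalIntegrable (by fun_prop) _ _)]
  simp only [integral_deriv_mul_sin_eq_neg_derivSinCoeff h.left hc hx]
  ring

lemma derivSinCoeff_recurrence (h : IsInceSystem ε l x y) (hε : |ε| < 1)
    (hx : x (π / 2) = 0) (hy : y 0 = 0) {n : ℝ} (hn : Real.cos (n * (π / 2)) = 0) :
    l * derivSinCoeff x n = n ^ 2 * (derivSinCoeff x n +
      ε / 2 * (derivSinCoeff x (n + 2) + derivSinCoeff x (n - 2))) := by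
  have hparts := h.mul_integral_right_mul_sin hy hn
  rw [h.integral_right_mul_sin hε hx] at hparts
  linear_combination hparts

lemma bddAbove_range_abs_derivSinCoeff (h : IsInceSystem ε l x y) (hε : |ε| < 1)
    (hx : x (π / 2) = 0) (n : ℕ → ℝ) :
    BddAbove (Set.range fun j => |derivSinCoeff x (n j)|) := by
  have hc := h.continuous_deriv hε
  obtain ⟨B, hB⟩ := isCompact_Icc.exists_bound_of_continuousOn hc.continuousOn
  exact ⟨B * (π / 2), Set.forall_mem_range.2 fun j => abs_derivSinCoeff_le h.left hc hx hB _⟩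

/-- Dividing by `δ` makes the off-diagonal entries of the recurrence independent of `δ`, so that
`1 / δ` becomes the spectral parameter. The first step closes up because the coefficients are odd
in `n`. -/
lemma isLadder_derivSinCoeff (hω : ω ≠ 0) (hδ : δ ≠ 0)
    (h : IsInceSystem (δ * γ) (4 * (δ / ω ^ 2)) x y) (hε : |δ * γ| < 1)
    (hx : x (π / 2) = 0) (hy : y 0 = 0) :
    IsLadder (fun j => δ⁻¹ - (resonance ω j)⁻¹) (γ / 2) (-(γ / 2))
      fun j => derivSinCoeff x (2 * j + 1) := by
  have hstep (j : ℕ) : (δ⁻¹ - (resonance ω j)⁻¹) * derivSinCoeff x (2 * j + 1) + γ / 2 *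
      (derivSinCoeff x (2 * j + 1 + 2) + derivSinCoeff x (2 * j + 1 - 2)) = 0 := by
    have hrec := h.derivSinCoeff_recurrence hε hx hy (cos_odd_mul_pi_div_two j)
    have hn : (2 * (j : ℝ) + 1) ≠ 0 := by positivity
    rw [resonance]
    field_simp at hrec ⊢
    linear_combination -hrec
  refine ⟨?_, fun j => ?_⟩
  · have hzero := hstep 0
    have hodd : derivSinCoeff x (2 * ((0 : ℕ) : ℝ) + 1 - 2) = -derivSinCoeff x 1 := by
      rw [← derivSinCoeff_neg]
      norm_num
    rw [hodd] at hzero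
    norm_num at hzero ⊢
    linear_combination hzero
  · have hsucc := hstep (j + 1)
    rwa [show 2 * ((j + 1 : ℕ) : ℝ) + 1 + 2 = 2 * ((j + 2 : ℕ) : ℝ) + 1 by push_cast; ring,
      show 2 * ((j + 1 : ℕ) : ℝ) + 1 - 2 = 2 * (j : ℝ) + 1 by push_cast; ring] at hsucc

end IsInceSystem

end Fourier

section TransitionCurves

lemma exists_bounds_abs_sub_of_strictAnti {κ : ℕ → ℝ} (h : StrictAnti κ) (h0 : ∀ j, 0 ≤ κ j)
    (K : ℕ) : ∃ c C, 0 < c ∧ ∀ j, j ≠ K → c ≤ |κ j - κ K| ∧ |κ j - κ K| ≤ C := by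
  have hgap : ∃ c, 0 < c ∧ ∀ j, j ≠ K → c ≤ |κ j - κ K| := by
    have hright : 0 < κ K - κ (K + 1) := sub_pos.2 (h K.lt_succ_self)
    have hlt (j : ℕ) (hj : K < j) : κ K - κ (K + 1) ≤ |κ j - κ K| := by
      rw [abs_sub_comm]
      exact (sub_le_sub_left (h.antitone hj) _).trans (le_abs_self _)
    rcases K with _ | K
    · exact ⟨_, hright, fun j hj => hlt j (Nat.pos_of_ne_zero hj)⟩
    · have hleft : 0 < κ K - κ (K + 1) := sub_pos.2 (h K.lt_succ_self)
      refine ⟨_, lt_min hleft hright, fun j hj => hj.lt_or_gt.elim (fun hjK => ?_)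
        fun hKj => (min_le_right _ _).trans (hlt j hKj)⟩
      exact (min_le_left _ _).trans
        ((sub_le_sub_right (h.antitone (Nat.le_of_lt_succ hjK)) _).trans (le_abs_self _))
  obtain ⟨c, hc, hgap⟩ := hgap
  refine ⟨c, κ 0, hc, fun j hj => ⟨hgap j hj, abs_sub_le_of_nonneg_of_le (h0 j) ?_ (h0 K) ?_⟩⟩
  · exact h.antitone j.zero_le
  · exact h.antitone K.zero_le

/-- The half-period value `x (π / 2)` of the solution with `x 0 = 1`, `x' 0 = 0`, as a function of
`p = (γ, δ)`. Its zeros are the parameters with an even `2π`-periodic solution. -/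
noncomputable def inceCharacteristic (ω : ℝ) (p : ℝ × ℝ) : ℝ :=
  inceEven (p.2 * p.1) (4 * (p.2 / ω ^ 2)) (π / 2)

variable {ω γ δ : ℝ} {p : ℝ × ℝ}

lemma analyticAt_inceParameters (ω : ℝ) (p : ℝ × ℝ) :
    AnalyticAt ℝ (fun p : ℝ × ℝ => (p.2 * p.1, 4 * (p.2 / ω ^ 2))) p := by
  simp only [div_eq_mul_inv]
  exact (analyticAt_snd.mul analyticAt_fst).prod
    (analyticAt_const.mul (analyticAt_snd.mul analyticAt_const))

lemma analyticAt_inceCharacteristic (hp : |p.2 * p.1| < 1) :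
    AnalyticAt ℝ (inceCharacteristic ω) p :=
  AnalyticAt.comp (f := fun p : ℝ × ℝ => (p.2 * p.1, 4 * (p.2 / ω ^ 2)))
    (analyticAt_inceEven hp _ (π / 2)) (analyticAt_inceParameters ω p)

lemma inceFlow_snd_eq_inceCharacteristic (hε : |δ * γ| < 1) :
    (inceFlow (δ * γ) (4 * (δ / ω ^ 2)) (π / 2) (0, 1)).2 = inceCharacteristic ω (-γ, δ) := by
  rw [inceFlow_snd_pi_div_two hε, inceCharacteristic, mul_neg]

lemma inceCharacteristic_zero_fst (hδ : 0 ≤ δ) :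
    inceCharacteristic ω (0, δ) = Real.cos (√δ * (π / ω)) := by
  have hsq : 4 * (δ / ω ^ 2) = (2 * √δ / ω) ^ 2 := by
    rw [div_pow, mul_pow, Real.sq_sqrt hδ]
    ring
  rw [inceCharacteristic, mul_zero, hsq, inceEven_zero_sq]
  ring_nf

lemma hasDerivAt_inceCharacteristic_zero_fst (hδ : 0 < δ) :
    HasDerivAt (fun δ => inceCharacteristic ω (0, δ))
      (-Real.sin (√δ * (π / ω)) * (1 / (2 * √δ) * (π / ω))) δ :=
  ((Real.hasDerivAt_sqrt hδ.ne').mul_const _).cos.congr_of_eventuallyEq <|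
    (lt_mem_nhds hδ).mono fun _ h => inceCharacteristic_zero_fst h.le

lemma four_mul_resonance_div_sq (hω : 0 < ω) (K : ℕ) :
    4 * (resonance ω K / ω ^ 2) = (2 * K + 1) ^ 2 := by
  rw [resonance]
  field_simp
  norm_num

lemma inceCharacteristic_resonance (hω : 0 < ω) (K : ℕ) :
    inceCharacteristic ω (0, resonance ω K) = 0 := by
  rw [inceCharacteristic, four_mul_resonance_div_sq hω, mul_zero, inceEven_zero_sq,
    cos_odd_mul_pi_div_two]

lemma exists_hasDerivAt_inceCharacteristic_ne_zero (hω : 0 < ω) (K : ℕ) :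
    ∃ m ≠ 0, HasDerivAt (fun δ => inceCharacteristic ω (0, δ)) m (resonance ω K) := by
  have hpos := resonance_pos hω K
  have hcos := inceCharacteristic_resonance hω K
  rw [inceCharacteristic_zero_fst hpos.le] at hcos
  refine ⟨_, mul_ne_zero (neg_ne_zero.2 fun hsin => ?_) (by positivity),
    hasDerivAt_inceCharacteristic_zero_fst hpos⟩
  simpa [hcos, hsin] using Real.sin_sq_add_cos_sq (√(resonance ω K) * (π / ω))

lemma tendsto_neg_fst (δ₀ : ℝ) :
    Filter.Tendsto (fun p : ℝ × ℝ => (-p.1, p.2)) (𝓝 (0, δ₀)) (𝓝 (0, δ₀)) := by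
  have hcont : Continuous fun p : ℝ × ℝ => (-p.1, p.2) := by fun_prop
  simpa using hcont.tendsto (0, δ₀)

lemma eventually_abs_mul_lt_one (δ₀ : ℝ) :
    ∀ᶠ p : ℝ × ℝ in 𝓝 (0, δ₀), |p.2 * p.1| < 1 := by
  have hcont : Continuous fun p : ℝ × ℝ => |p.2 * p.1| := by fun_prop
  exact hcont.continuousAt.eventually_lt_const (by simp)

lemma eventually_inceCharacteristic_mul_lt_one (hω : 0 < ω) (K : ℕ) :
    ∀ᶠ p : ℝ × ℝ in 𝓝 (0, resonance ω K),
      inceCharacteristic ω p * inceCharacteristic ω (-p.1, p.2) < 1 := by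
  have hlim : Filter.Tendsto (inceCharacteristic ω) (𝓝 (0, resonance ω K)) (𝓝 0) := by
    have hcont := (analyticAt_inceCharacteristic (ω := ω) (p := (0, resonance ω K))
      (by simp)).continuousAt.tendsto
    rwa [inceCharacteristic_resonance hω] at hcont
  exact (hlim.mul (hlim.comp (tendsto_neg_fst _))).eventually_lt_const (by simp)

lemma eventually_inceCharacteristic_criteria (hω : 0 < ω) (K : ℕ) :
    ∀ᶠ p : ℝ × ℝ in 𝓝 (0, resonance ω K),
      (HasEvenPeriodicSolution ω p.1 p.2 ↔ inceCharacteristic ω p = 0) ∧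
      (HasOddPeriodicSolution ω p.1 p.2 ↔ inceCharacteristic ω (-p.1, p.2) = 0) ∧
      (OriginStable ω p.1 p.2 ↔
        0 < inceCharacteristic ω p * inceCharacteristic ω (-p.1, p.2) ∨
          inceCharacteristic ω p = 0 ∧ inceCharacteristic ω (-p.1, p.2) = 0) := by
  filter_upwards [eventually_abs_mul_lt_one _, eventually_inceCharacteristic_mul_lt_one hω K]
    with p hε hlt
  have hpair := isFundamentalPair_inceFlow hε (4 * (p.2 / ω ^ 2))
  rw [← inceFlow_snd_eq_inceCharacteristic hε] at hlt ⊢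
  exact ⟨hasEvenPeriodicSolution_iff hε hpair hlt, hasOddPeriodicSolution_iff hε hpair hlt,
    originStable_iff hε hpair hlt⟩

theorem exists_transitionCurve (hω : 0 < ω) (K : ℕ) :
    ∃ a : ℝ → ℝ, AnalyticAt ℝ a 0 ∧ a 0 = resonance ω K ∧
      (∀ᶠ γ in 𝓝 0, inceCharacteristic ω (γ, a γ) = 0) ∧
      ∀ᶠ p : ℝ × ℝ in 𝓝 (0, resonance ω K),
        (HasEvenPeriodicSolution ω p.1 p.2 ↔ p.2 = a p.1) ∧
        (HasOddPeriodicSolution ω p.1 p.2 ↔ p.2 = a (-p.1)) ∧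
        (OriginStable ω p.1 p.2 ↔ p ∈ wedgeExterior a fun γ => a (-γ)) := by
  obtain ⟨m, hm0, hm⟩ := exists_hasDerivAt_inceCharacteristic_ne_zero hω K
  obtain ⟨a, ha, ha0, hzero, hsign⟩ := exists_analyticAt_implicit
    (analyticAt_inceCharacteristic (by simp)) (inceCharacteristic_resonance hω K) hm hm0
  refine ⟨a, ha, ha0, hzero, ?_⟩
  filter_upwards [eventually_inceCharacteristic_criteria hω K, hsign,
    (tendsto_neg_fst _).eventually hsign] with p ⟨heven, hodd, hstable⟩ hs hs'
  have hms : SignType.sign m * SignType.sign m = 1 := by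
    rw [← sign_mul, sign_eq_one_iff]
    exact mul_self_pos.2 hm0
  have hzero_iff {u v : ℝ} (h : SignType.sign u = SignType.sign m * SignType.sign v) :
      u = 0 ↔ v = 0 := by
    rw [← sign_eq_zero_iff, h, ← sign_mul, sign_eq_zero_iff, mul_eq_zero_iff_left hm0]
  have hpos_iff : 0 < inceCharacteristic ω p * inceCharacteristic ω (-p.1, p.2) ↔
      0 < (p.2 - a p.1) * (p.2 - a (-p.1)) := by
    rw [← sign_eq_one_iff, sign_mul, hs, hs', mul_mul_mul_comm, hms, one_mul, ← sign_mul,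
      sign_eq_one_iff]
  rw [heven, hodd, hstable, hpos_iff, hzero_iff hs, hzero_iff hs', sub_eq_zero, sub_eq_zero]
  exact ⟨Iff.rfl, Iff.rfl, Iff.rfl⟩

lemma eventually_derivSinCoeff_ne_zero (hω : 0 < ω) (K : ℕ) :
    ∀ᶠ p : ℝ × ℝ in 𝓝 (0, resonance ω K),
      derivSinCoeff (inceEven (p.2 * p.1) (4 * (p.2 / ω ^ 2))) (2 * K + 1) ≠ 0 := by
  have hparam := (analyticAt_inceParameters ω (0, resonance ω K)).continuousAt.tendsto
  simp only [mul_zero, four_mul_resonance_div_sq hω] at hparam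
  have hbase : ∫ t in (0 : ℝ)..π / 2, inceEven 0 ((2 * (K : ℝ) + 1) ^ 2) t *
      Real.cos ((2 * K + 1) * t) ≠ 0 := by
    simp only [inceEven_zero_sq, ← sq, integral_cos_sq_odd]
    positivity
  have hcont := continuousAt_integral_inceEven_mul_cos (ε := 0) (by simp)
    ((2 * (K : ℝ) + 1) ^ 2) (2 * K + 1) (π / 2)
  filter_upwards [hparam.eventually (hcont.eventually_ne hbase)] with p hp
  exact mul_ne_zero (by positivity) hp

lemma eventually_isLadder_derivSinCoeff {α : Type*} {l : Filter α} {σ θ : α → ℝ} (hω : 0 < ω)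
    {K : ℕ} (hσ : Filter.Tendsto σ l (𝓝 0)) (hθ : Filter.Tendsto θ l (𝓝 (resonance ω K)))
    (h0 : ∀ᶠ i in l, inceCharacteristic ω (σ i, θ i) = 0) :
    ∀ᶠ i in l, ∃ z : ℕ → ℝ,
      IsLadder (fun j => (θ i)⁻¹ - (resonance ω j)⁻¹) (σ i / 2) (-(σ i / 2)) z ∧
      BddAbove (Set.range fun j => |z j|) ∧ z K ≠ 0 := by
  have hlim := hσ.prodMk_nhds hθ
  filter_upwards [h0, hθ.eventually_ne (resonance_pos hω K).ne',
    hlim.eventually (eventually_abs_mul_lt_one _),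
    hlim.eventually (eventually_derivSinCoeff_ne_zero hω K)] with i hx hθi hε hK
  have hpair := isFundamentalPair_inceFlow hε (4 * (θ i / ω ^ 2))
  exact ⟨_, IsInceSystem.isLadder_derivSinCoeff hω.ne' hθi hpair.fst hε hx hpair.y₁_zero,
    IsInceSystem.bddAbove_range_abs_derivSinCoeff hpair.fst hε hx _, hK⟩

theorem isTheta_sub_comp_neg_of_inceCharacteristic_eq_zero {a : ℝ → ℝ} (hω : 0 < ω) {K : ℕ}
    (ha : Filter.Tendsto a (𝓝 0) (𝓝 (resonance ω K)))
    (ha0 : ∀ᶠ γ in 𝓝 0, inceCharacteristic ω (γ, a γ) = 0) :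
    (fun γ => a γ - a (-γ)) =Θ[𝓝 0] fun γ => γ ^ (2 * K + 1) := by
  have hpos := resonance_pos hω K
  obtain ⟨c, C, hc, hκ⟩ := exists_bounds_abs_sub_of_strictAnti (strictAnti_inv_resonance hω)
    (fun j => (inv_pos.2 (resonance_pos hω j)).le) K
  have hneg : Filter.Tendsto (fun γ : ℝ => -γ) (𝓝 0) (𝓝 0) := continuous_neg.tendsto' 0 0 neg_zero
  have hhalf : Filter.Tendsto (fun γ : ℝ => γ / 2) (𝓝 0) (𝓝 0) :=
    (continuous_id.div_const 2).tendsto' 0 0 (zero_div 2)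
  have hb := ha.comp hneg
  have hinv : (fun γ => (a γ)⁻¹ - (a (-γ))⁻¹) =Θ[𝓝 0] fun γ => (γ / 2) ^ (2 * K + 1) := by
    refine isTheta_sub_of_isLadder hc hκ hhalf (ha.inv₀ hpos.ne') (hb.inv₀ hpos.ne')
      (eventually_isLadder_derivSinCoeff hω Filter.tendsto_id ha ha0) ?_
    filter_upwards [eventually_isLadder_derivSinCoeff hω hneg hb (hneg.eventually ha0)]
      with γ ⟨w, hw, hbdd, hK⟩
    rw [neg_div, neg_neg] at hw
    refine ⟨_, hw.alternate, ?_, mul_ne_zero (pow_ne_zero _ (by simp)) hK⟩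
    simpa [abs_mul, abs_pow] using hbdd
  have hprod : (fun γ => -(a γ * a (-γ))) =Θ[𝓝 0] fun _ => (1 : ℝ) :=
    isTheta_one_of_tendsto (ha.mul hb).neg (by simp [hpos.ne'])
  calc (fun γ => a γ - a (-γ))
      =ᶠ[𝓝 0] fun γ => -(a γ * a (-γ)) * ((a γ)⁻¹ - (a (-γ))⁻¹) := by
        filter_upwards [ha.eventually_ne hpos.ne', hb.eventually_ne hpos.ne'] with γ haγ hbγ
        have hbγ : a (-γ) ≠ 0 := hbγ
        field_simp
        ring
    _ =Θ[𝓝 0] fun γ => 1 * (γ / 2) ^ (2 * K + 1) := hprod.mul hinv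
    _ =Θ[𝓝 0] fun γ => γ ^ (2 * K + 1) := by
        simp only [one_mul, div_eq_inv_mul, mul_pow]
        exact Asymptotics.IsTheta.const_mul_left (by simp) Asymptotics.isTheta_rfl

end TransitionCurves

theorem proposition1 (ω : ℝ) (hω : 0 < ω) (k : ℕ) (hk : 1 ≤ k) :
    ∃ a b : ℝ → ℝ,
      -- two analytic curves `δ = a γ`, `δ = b γ` emanating from `((2k-1)ω/2)²`
      AnalyticAt ℝ a 0 ∧ AnalyticAt ℝ b 0 ∧
      a 0 = ((2 * (k : ℝ) - 1) * ω / 2) ^ 2 ∧ b 0 = ((2 * (k : ℝ) - 1) * ω / 2) ^ 2 ∧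
      (∀ᶠ p : ℝ × ℝ in 𝓝 ((0 : ℝ), ((2 * (k : ℝ) - 1) * ω / 2) ^ 2),
        -- they are the transition curves near that point: the periodic-solution loci ...
        (HasEvenPeriodicSolution ω p.1 p.2 ↔ p.2 = a p.1) ∧
        (HasOddPeriodicSolution ω p.1 p.2 ↔ p.2 = b p.1) ∧
        -- ... and the boundary of the stability region
        (p ∈ stabilityBoundary ω ↔ p.2 = a p.1 ∨ p.2 = b p.1) ∧
        -- the instability tongue is what lies between them
        (¬ OriginStable ω p.1 p.2 ↔ p.1 ≠ 0 ∧ p.2 ∈ Set.uIcc (a p.1) (b p.1))) ∧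
      -- the expansions agree up to order `2k-2` and differ at order `2k-1`
      (∀ j ≤ 2 * k - 2, iteratedDeriv j a 0 = iteratedDeriv j b 0) ∧
      iteratedDeriv (2 * k - 1) a 0 ≠ iteratedDeriv (2 * k - 1) b 0 ∧
      -- the width of the tongue is of order exactly `γ^(2k-1)`
      (fun γ : ℝ => |a γ - b γ|) =Θ[𝓝 0] (fun γ : ℝ => γ ^ (2 * k - 1)) := by
  obtain ⟨K, rfl⟩ := Nat.exists_eq_add_of_le' hk
  have hn : 2 * (K + 1) - 1 = 2 * K + 1 := by lia
  have hresonance : ((2 * ((K + 1 : ℕ) : ℝ) - 1) * ω / 2) ^ 2 = resonance ω K := by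
    rw [resonance]
    push_cast
    ring
  obtain ⟨a, ha, ha0, hroot, hlocal⟩ := exists_transitionCurve hω K
  have hb : AnalyticAt ℝ (fun γ => a (-γ)) 0 := ha.fun_comp_of_eq analyticAt_id.neg neg_zero
  have hwidth := isTheta_sub_comp_neg_of_inceCharacteristic_eq_zero hω
    (ha0 ▸ ha.continuousAt.tendsto) hroot
  obtain ⟨hagree, hsplit⟩ := iteratedDeriv_eq_and_ne_of_isTheta ha hb (by simpa using hwidth)
  have hne : ∀ᶠ γ in 𝓝 0, a γ ≠ a (-γ) ↔ γ ≠ 0 := hwidth.eq_zero_iff.mono fun γ hγ => by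
    rw [ne_eq, ← sub_eq_zero, hγ, pow_eq_zero_iff (by lia)]
  have hfrontier := eventually_mem_frontier_iff ha.eventually_continuousAt
    hb.eventually_continuousAt (eventually_nhdsWithin_iff.2 (hne.mono fun _ => Iff.mpr))
    (S := {p | OriginStable ω p.1 p.2}) (hlocal.mono fun _ h => h.2.2)
  rw [hresonance, hn]
  refine ⟨a, fun γ => a (-γ), ha, hb, ha0, (congrArg a neg_zero).trans ha0, ?_,
    fun j hj => hagree j (by lia), hsplit, hwidth.norm_left⟩
  filter_upwards [hlocal, hfrontier, continuousAt_fst.eventually hne]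
    with p ⟨heven, hodd, hstable⟩ hboundary hp
  exact ⟨heven, hodd, hboundary, by rw [hstable, notMem_wedgeExterior_iff, hp]⟩
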